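/- Let $\mathbb{H}^3$ be hyperbolic $3$-space of curvature $-1$. A \emph{closed convex surface} in $\mathbb{H}^3$ is the boundary of a nonempty compact (geodesically) convex set $K\subset\mathbb{H}^3$; it is \emph{nondegenerate} if $K$ has interior points. For points $A,B$ of a closed convex surface $\mathcal{F}$, let $\mathrm{d}_{\mathcal{F}}(A,B)$ be the intrinsic distance, i.e. the infimum of the lengths (with respect to the hyperbolic metric) of the curves in $\mathcal{F}$ from $A$ to $B$. \textbf{Theorem.} Let $(\mathcal{F}_n)_{n\in\mathbb{N}}$ be a sequence of closed convex surfaces in $\mathbb{H}^3$ which converges, in the Hausdorff distance, to a nondegenerate closed convex surface $\mathcal{F}$. Let $X_n,Y_n\in\mathcal{F}_n$ be points which converge in $\mathbb{H}^3$ to points $X,Y\in\mathcal{F}$, respectively. Then all the distances $\mathrm{d}_{\mathcal{F}_n}(X_n,Y_n)$ and $\mathrm{d}_{\mathcal{F}}(X,Y)$ are finite, and $$\lim_{n\to\infty}\mathrm{d}_{\mathcal{F}_n}(X_n,Y_n)=\mathrm{d}_{\mathcal{F}}(X,Y).$$ -/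

import Mathlib

open Set Filter Topology
open scoped ENNReal

/-- The Minkowski scalar product `-x₀y₀ + x₁y₁ + x₂y₂ + x₃y₃` on `ℝ⁴`. -/
def minkowski (x y : Fin 4 → ℝ) : ℝ :=
  -(x 0 * y 0) + x 1 * y 1 + x 2 * y 2 + x 3 * y 3

/-- Hyperbolic 3-space `ℍ³` of curvature `-1`, in the hyperboloid model: the vectors `x` of `ℝ⁴`
with Minkowski square `-1` and `x₀ > 0`. -/
@[ext]
structure Hyp3 where
  /-- The coordinates in `ℝ⁴`. -/
  coord : Fin 4 → ℝ
  minkowski_self : minkowski coord coord = -1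
  coord_zero_pos : 0 < coord 0

namespace Hyp3

theorem minkowski_comm (x y : Fin 4 → ℝ) : minkowski x y = minkowski y x := by
  simp only [minkowski]; ring

/-- The Minkowski product is positive on the orthogonal complement of a point of `ℍ³`. -/
theorem sq_le_of_orthogonal (y : Hyp3) (w : Fin 4 → ℝ) (h : minkowski w y.coord = 0) :
    w 1 ^ 2 + w 2 ^ 2 + w 3 ^ 2 ≤ y.coord 0 ^ 2 * minkowski w w := by
  have hy := y.minkowski_self
  simp only [minkowski] at *
  have h1 : w 0 * y.coord 0 = w 1 * y.coord 1 + w 2 * y.coord 2 + w 3 * y.coord 3 := by linarith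
  have h2 : (w 0 * y.coord 0) ^ 2 ≤ (w 1 ^ 2 + w 2 ^ 2 + w 3 ^ 2) * (y.coord 0 ^ 2 - 1) := by
    have h3 : y.coord 0 ^ 2 - 1 = y.coord 1 ^ 2 + y.coord 2 ^ 2 + y.coord 3 ^ 2 := by linarith
    rw [h1, h3]
    nlinarith [sq_nonneg (w 1 * y.coord 2 - w 2 * y.coord 1),
      sq_nonneg (w 1 * y.coord 3 - w 3 * y.coord 1),
      sq_nonneg (w 2 * y.coord 3 - w 3 * y.coord 2)]
  nlinarith

theorem minkowski_nonneg_of_orthogonal (y : Hyp3) (w : Fin 4 → ℝ)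
    (h : minkowski w y.coord = 0) : 0 ≤ minkowski w w := by
  have h1 := sq_le_of_orthogonal y w h
  have h2 : 0 < y.coord 0 ^ 2 := pow_pos y.coord_zero_pos 2
  by_contra! h3
  nlinarith [sq_nonneg (w 1), sq_nonneg (w 2), sq_nonneg (w 3), mul_neg_of_pos_of_neg h2 h3]

theorem one_le_neg_minkowski (x y : Hyp3) : 1 ≤ -minkowski x.coord y.coord := by
  have hx := x.minkowski_self
  have hy := y.minkowski_self
  have px := x.coord_zero_pos
  have py := y.coord_zero_pos
  have h1 := minkowski_nonneg_of_orthogonal y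
    (fun i => x.coord i + minkowski x.coord y.coord * y.coord i) (by
      have : minkowski (fun i => x.coord i + minkowski x.coord y.coord * y.coord i) y.coord
          = minkowski x.coord y.coord + minkowski x.coord y.coord * minkowski y.coord y.coord := by
        simp only [minkowski]; ring
      rw [this, hy]; ring)
  have h2 : minkowski (fun i => x.coord i + minkowski x.coord y.coord * y.coord i)
      (fun i => x.coord i + minkowski x.coord y.coord * y.coord i)
      = minkowski x.coord x.coord + 2 * minkowski x.coord y.coord ^ 2
        + minkowski x.coord y.coord ^ 2 * minkowski y.coord y.coord := by
    simp only [minkowski]; ring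
  rw [h2, hx, hy] at h1
  have h3 : 0 < -minkowski x.coord y.coord := by
    simp only [minkowski] at hx hy ⊢
    have h4 : (x.coord 1 * y.coord 1 + x.coord 2 * y.coord 2 + x.coord 3 * y.coord 3) ^ 2
        < (x.coord 0 * y.coord 0) ^ 2 := by
      have e1 : x.coord 0 ^ 2 = 1 + (x.coord 1 ^ 2 + x.coord 2 ^ 2 + x.coord 3 ^ 2) := by linarith
      have e2 : y.coord 0 ^ 2 = 1 + (y.coord 1 ^ 2 + y.coord 2 ^ 2 + y.coord 3 ^ 2) := by linarith
      rw [mul_pow, e1, e2]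
      nlinarith [sq_nonneg (x.coord 1 * y.coord 2 - x.coord 2 * y.coord 1),
        sq_nonneg (x.coord 1 * y.coord 3 - x.coord 3 * y.coord 1),
        sq_nonneg (x.coord 2 * y.coord 3 - x.coord 3 * y.coord 2),
        sq_nonneg (x.coord 1), sq_nonneg (x.coord 2), sq_nonneg (x.coord 3),
        sq_nonneg (y.coord 1), sq_nonneg (y.coord 2), sq_nonneg (y.coord 3)]
    have h5 := lt_of_pow_lt_pow_left₀ 2 (mul_pos px py).le h4
    linarith
  nlinarith

/-- The hyperbolic distance: `cosh d(x, y) = -(x, y)`. -/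
noncomputable def hdist (x y : Hyp3) : ℝ := Real.arcosh (-minkowski x.coord y.coord)

theorem hdist_triangle (x y z : Hyp3) : hdist x z ≤ hdist x y + hdist y z := by
  have ha := one_le_neg_minkowski x y
  have hb := one_le_neg_minkowski y z
  have hc := one_le_neg_minkowski x z
  have hx := x.minkowski_self
  have hy := y.minkowski_self
  have hz := z.minkowski_self
  unfold hdist
  have hs : 0 ≤ Real.arcosh (-minkowski x.coord y.coord)
      + Real.arcosh (-minkowski y.coord z.coord) :=
    add_nonneg (Real.arcosh_nonneg ha) (Real.arcosh_nonneg hb)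
  rw [← Real.arcosh_cosh hs, Real.arcosh_le_arcosh (by linarith) (Real.cosh_pos _), Real.cosh_add,
    Real.cosh_arcosh ha, Real.cosh_arcosh hb, Real.sinh_arcosh ha, Real.sinh_arcosh hb]
  set a := minkowski x.coord y.coord with ha'
  set b := minkowski y.coord z.coord with hb'
  set c := minkowski x.coord z.coord with hc'
  have key : ∀ s : ℝ, 0 ≤ (a ^ 2 - 1) * (s * s) + 2 * (c + a * b) * s + (b ^ 2 - 1) := by
    intro s
    have h1 := minkowski_nonneg_of_orthogonal y
      (fun i => s * (x.coord i + a * y.coord i) + (z.coord i + b * y.coord i)) (by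
        have : minkowski (fun i => s * (x.coord i + a * y.coord i) + (z.coord i + b * y.coord i))
            y.coord = s * (a + a * minkowski y.coord y.coord)
              + (b + b * minkowski y.coord y.coord) := by
          rw [ha', hb']; simp only [minkowski]; ring
        rw [this, hy]; ring)
    have h2 : minkowski (fun i => s * (x.coord i + a * y.coord i) + (z.coord i + b * y.coord i))
        (fun i => s * (x.coord i + a * y.coord i) + (z.coord i + b * y.coord i))
        = s ^ 2 * (minkowski x.coord x.coord + 2 * a * minkowski x.coord y.coord
            + a ^ 2 * minkowski y.coord y.coord)
          + 2 * s * (minkowski x.coord z.coord + b * minkowski x.coord y.coord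
            + a * minkowski y.coord z.coord + a * b * minkowski y.coord y.coord)
          + (minkowski z.coord z.coord + 2 * b * minkowski y.coord z.coord
            + b ^ 2 * minkowski y.coord y.coord) := by
      simp only [minkowski]; ring
    rw [h2, hx, hy, hz, ← ha', ← hb', ← hc'] at h1
    linarith
  have hdisc := discrim_le_zero key
  unfold discrim at hdisc
  have h3 : (c + a * b) ^ 2 ≤ (a ^ 2 - 1) * (b ^ 2 - 1) := by nlinarith
  have h4 : |c + a * b| ≤ √((a ^ 2 - 1) * (b ^ 2 - 1)) := Real.abs_le_sqrt h3
  rw [Real.sqrt_mul (by nlinarith)] at h4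
  have h5 := neg_le_abs (c + a * b)
  rw [neg_sq, neg_sq]
  linarith

theorem eq_of_hdist_eq_zero {x y : Hyp3} (h : hdist x y = 0) : x = y := by
  have h1 : minkowski x.coord y.coord = -1 := by
    have := (Real.arcosh_eq_zero_iff (one_le_neg_minkowski x y)).1 h
    linarith
  have hx := x.minkowski_self
  have hy := y.minkowski_self
  have h2 : minkowski (fun i => x.coord i - y.coord i) y.coord = 0 := by
    have : minkowski (fun i => x.coord i - y.coord i) y.coord
        = minkowski x.coord y.coord - minkowski y.coord y.coord := by
      simp only [minkowski]; ring
    rw [this, h1, hy]; ring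
  have h3 : minkowski (fun i => x.coord i - y.coord i) (fun i => x.coord i - y.coord i) = 0 := by
    have : minkowski (fun i => x.coord i - y.coord i) (fun i => x.coord i - y.coord i)
        = minkowski x.coord x.coord - 2 * minkowski x.coord y.coord
          + minkowski y.coord y.coord := by
      simp only [minkowski]; ring
    rw [this, h1, hx, hy]; ring
  have h4 := sq_le_of_orthogonal y _ h2
  rw [h3, mul_zero] at h4
  have e1 : x.coord 1 - y.coord 1 = 0 := by
    nlinarith [sq_nonneg (x.coord 2 - y.coord 2), sq_nonneg (x.coord 3 - y.coord 3)]
  have e2 : x.coord 2 - y.coord 2 = 0 := by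
    nlinarith [sq_nonneg (x.coord 1 - y.coord 1), sq_nonneg (x.coord 3 - y.coord 3)]
  have e3 : x.coord 3 - y.coord 3 = 0 := by
    nlinarith [sq_nonneg (x.coord 2 - y.coord 2), sq_nonneg (x.coord 1 - y.coord 1)]
  have e0 : x.coord 0 - y.coord 0 = 0 := by
    simp only [minkowski, e1, e2, e3] at h3
    nlinarith
  ext i
  fin_cases i
  · exact sub_eq_zero.1 e0
  · exact sub_eq_zero.1 e1
  · exact sub_eq_zero.1 e2
  · exact sub_eq_zero.1 e3

/-- `ℍ³` as a metric space, with the hyperbolic distance. -/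
noncomputable instance : MetricSpace Hyp3 where
  dist := hdist
  dist_self x := by
    rw [hdist, x.minkowski_self, neg_neg, Real.arcosh_eq_zero_iff le_rfl]
  dist_comm x y := by
    rw [hdist, hdist, minkowski_comm]
  dist_triangle := hdist_triangle
  eq_of_dist_eq_zero := eq_of_hdist_eq_zero

/-- The geodesic segment `[x, y]` of `ℍ³`: the points at which the triangle inequality between `x`
and `y` is an equality. -/
def segment (x y : Hyp3) : Set Hyp3 := {z | dist x z + dist z y = dist x y}

/-- (Geodesic) convexity in `ℍ³`. -/
def IsConvex (K : Set Hyp3) : Prop := ∀ x ∈ K, ∀ y ∈ K, segment x y ⊆ K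

/-- A closed convex surface in `ℍ³`: the boundary of a nonempty compact convex set. Degenerate
surfaces (those of sets without interior points) are included. -/
def IsClosedConvexSurface (F : Set Hyp3) : Prop :=
  ∃ K : Set Hyp3, K.Nonempty ∧ IsCompact K ∧ IsConvex K ∧ F = frontier K

/-- A nondegenerate closed convex surface in `ℍ³`: the boundary of a compact convex set with
interior points. -/
def IsNondegenerateClosedConvexSurface (F : Set Hyp3) : Prop :=
  ∃ K : Set Hyp3, (interior K).Nonempty ∧ IsCompact K ∧ IsConvex K ∧ F = frontier K

/-- `γ`, restricted to `[0, 1]`, is a (continuous) curve that runs in `F` from `X` to `Y`. -/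
def IsCurveIn (F : Set Hyp3) (X Y : Hyp3) (γ : ℝ → Hyp3) : Prop :=
  ContinuousOn γ (Icc 0 1) ∧ MapsTo γ (Icc 0 1) F ∧ γ 0 = X ∧ γ 1 = Y

/-- The length of `γ` restricted to `[0, 1]`: the supremum of the lengths of inscribed broken
lines. -/
noncomputable def curveLength (γ : ℝ → Hyp3) : ℝ≥0∞ := eVariationOn γ (Icc 0 1)

/-- The intrinsic distance `d_F(X, Y)`: the infimum of the lengths of the curves in `F` from `X`
to `Y` (`∞` if there is no rectifiable one). -/
noncomputable def intrinsicDist (F : Set Hyp3) (X Y : Hyp3) : ℝ≥0∞ :=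
  ⨅ (γ : ℝ → Hyp3) (_ : IsCurveIn F X Y γ), curveLength γ

/-- Convergence of a sequence of surfaces: the Hausdorff distance tends to zero. -/
def SurfacesConverge (F : ℕ → Set Hyp3) (F' : Set Hyp3) : Prop :=
  Tendsto (fun n => Metric.hausdorffEDist (F n) F') atTop (𝓝 0)

end Hyp3

/-!
The theorem rests on two facts about a compact convex set `K` of `ℍ³` with an interior point `o`.

* The nearest-point projection onto `K` is `1`-Lipschitz and maps the complement of the interior to
  the boundary (`IsConvex.exists_projection`). Hence every curve that avoids the interior of `K` and
  joins two boundary points is at least as long as their intrinsic distance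
  (`IsConvex.intrinsicDist_frontier_le`).
* A homothety with centre `o` and ratio slightly above `1`, taken in the projective model, is
  Lipschitz on bounded sets with a constant close to `1`, and moves points only a little
  (`exists_push`). It maps all points close to the boundary of `K` out of `K`, because `K` contains
  a neighbourhood of every point strictly between `o` and a point of `K`
  (`exists_ball_subset`); how close the points have to be depends only on an inner and an outer
  radius of `K`.

So if a set `F` is close to the boundary of `K`, a curve in `F` can be pushed out of `K` and
projected back, which bounds the intrinsic distance on the boundary of `K` by `1 + e` times the one
in `F`, up to an error of the order of `e` (`exists_intrinsicDist_frontier_le`). This applies with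
`F` the approximating surface and `K` bounded by the limit, and with the roles exchanged: the bodies
bounded by the approximating surfaces eventually contain a fixed ball around `o`
(`eventually_ball_subset`). The two bounds together give the convergence.

Distances are finite: two points of the boundary of `K` are joined outside the interior by a
rectifiable curve, composed of two radial segments and two circular arcs on a large sphere around
`o`, and this curve can be projected to the boundary. A convex set without interior points is
its own boundary and contains the geodesic between the two points.

All computations take place in the hyperboloid model: a point of the cone over `p` and `q` lies on
the segment `[p, q]` (`mem_segment_of_coord_eq`), and `-(o, x)` is `cosh d(o, x)`.
-/

namespace Hyp3

/-! ### The Minkowski product and geodesics -/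

theorem minkowski_add_left (u v w : Fin 4 → ℝ) :
    minkowski (u + v) w = minkowski u w + minkowski v w := by
  simp only [minkowski, Pi.add_apply]; ring

theorem minkowski_add_right (u v w : Fin 4 → ℝ) :
    minkowski u (v + w) = minkowski u v + minkowski u w := by
  simp only [minkowski, Pi.add_apply]; ring

theorem minkowski_sub_left (u v w : Fin 4 → ℝ) :
    minkowski (u - v) w = minkowski u w - minkowski v w := by
  simp only [minkowski, Pi.sub_apply]; ring

theorem minkowski_sub_right (u v w : Fin 4 → ℝ) :
    minkowski u (v - w) = minkowski u v - minkowski u w := by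
  simp only [minkowski, Pi.sub_apply]; ring

theorem minkowski_smul_left (s : ℝ) (u v : Fin 4 → ℝ) :
    minkowski (s • u) v = s * minkowski u v := by
  simp only [minkowski, Pi.smul_apply, smul_eq_mul]; ring

theorem minkowski_smul_right (s : ℝ) (u v : Fin 4 → ℝ) :
    minkowski u (s • v) = s * minkowski u v := by
  simp only [minkowski, Pi.smul_apply, smul_eq_mul]; ring

theorem cosh_dist (x y : Hyp3) : Real.cosh (dist x y) = -minkowski x.coord y.coord :=
  Real.cosh_arcosh (one_le_neg_minkowski x y)

theorem sinh_dist (x y : Hyp3) :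
    Real.sinh (dist x y) = √(minkowski x.coord y.coord ^ 2 - 1) := by
  rw [← neg_sq]; exact Real.sinh_arcosh (one_le_neg_minkowski x y)

theorem dist_le_of_cosh_le {x y : Hyp3} {c : ℝ} (hc : 0 ≤ c)
    (h : -minkowski x.coord y.coord ≤ Real.cosh c) : dist x y ≤ c := by
  rw [← cosh_dist, Real.cosh_le_cosh, abs_of_nonneg dist_nonneg, abs_of_nonneg hc] at h
  exact h

theorem dist_lt_of_cosh_lt {x y : Hyp3} {c : ℝ} (hc : 0 ≤ c)
    (h : -minkowski x.coord y.coord < Real.cosh c) : dist x y < c := by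
  rw [← cosh_dist, Real.cosh_lt_cosh, abs_of_nonneg dist_nonneg, abs_of_nonneg hc] at h
  exact h

theorem dist_le_of_sq_le {x y : Hyp3} {c : ℝ} (hc : 0 ≤ c)
    (h : minkowski x.coord y.coord ^ 2 - 1 ≤ c ^ 2) : dist x y ≤ c := by
  have h1 : Real.sinh (dist x y) ≤ c := by
    rw [sinh_dist]; exact (Real.sqrt_le_sqrt h).trans_eq (Real.sqrt_sq hc)
  exact (Real.self_le_sinh_iff.2 dist_nonneg).trans h1

theorem neg_minkowski_le_cosh {x y : Hyp3} {c : ℝ} (h : dist x y ≤ c) :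
    -minkowski x.coord y.coord ≤ Real.cosh c := by
  rw [← cosh_dist, Real.cosh_le_cosh, abs_of_nonneg dist_nonneg]
  exact h.trans (le_abs_self c)

/-- The Gram inequality for three points. With `a = cosh d(o, x)`, `b = cosh d(o, y)` and
`c = cosh d(x, y)` it reads `(a - b)² ≤ 2 a b (c - 1)`: close points have almost equal distances
from `o`, quantitatively. It follows from the positivity of the Minkowski product orthogonally to
`o`. -/
theorem gram_le (o x y : Hyp3) :
    (minkowski o.coord x.coord - minkowski o.coord y.coord) ^ 2 ≤
      2 * (minkowski o.coord x.coord * minkowski o.coord y.coord)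
        * (-minkowski x.coord y.coord - 1) := by
  set a := minkowski o.coord x.coord with ha
  set b := minkowski o.coord y.coord with hb
  set c := minkowski x.coord y.coord with hc
  have ho := o.minkowski_self
  have hx := x.minkowski_self
  have hy := y.minkowski_self
  have key : ∀ s : ℝ, 0 ≤ (a ^ 2 - 1) * (s * s) + 2 * (c + a * b) * s + (b ^ 2 - 1) := by
    intro s
    have h1 := minkowski_nonneg_of_orthogonal o
      (s • (x.coord + a • o.coord) + (y.coord + b • o.coord)) (by
        simp only [minkowski_add_left, minkowski_smul_left, minkowski_comm x.coord o.coord,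
          minkowski_comm y.coord o.coord, ← ha, ← hb, ho]
        ring)
    simp only [minkowski_add_left, minkowski_smul_left, minkowski_add_right, minkowski_smul_right,
      minkowski_comm x.coord o.coord, minkowski_comm y.coord o.coord,
      minkowski_comm y.coord x.coord, ← ha, ← hb, ← hc, ho, hx, hy] at h1
    linarith
  have hdisc := discrim_le_zero key
  unfold discrim at hdisc
  nlinarith [sq_nonneg (c + 1), one_le_neg_minkowski x y]

/-- The point of `ℍ³` on the ray spanned by a future timelike vector `v`; for all other `v`, the
base point `(1, 0, 0, 0)`. -/
noncomputable def normalize (v : Fin 4 → ℝ) : Hyp3 := by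
  classical
  exact
  if h : minkowski v v < 0 ∧ 0 < v 0 then
    { coord := (√(-minkowski v v))⁻¹ • v
      minkowski_self := by
        have h1 : 0 < -minkowski v v := by linarith [h.1]
        have h2 := Real.sq_sqrt h1.le
        have h3 := (Real.sqrt_pos.2 h1).ne'
        rw [minkowski_smul_left, minkowski_smul_right]
        field_simp
        linarith
      coord_zero_pos :=
        mul_pos (inv_pos.2 (Real.sqrt_pos.2 (by linarith [h.1]))) h.2 }
  else ⟨![1, 0, 0, 0], by simp [minkowski], by simp⟩

/-- A timelike vector is future-directed as soon as its product with one point of `ℍ³` is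
negative. -/
theorem zero_pos_of_timelike {v : Fin 4 → ℝ} (o : Hyp3) (h : minkowski v v < 0)
    (ho : minkowski v o.coord < 0) : 0 < v 0 := by
  by_contra! h0
  rcases h0.lt_or_eq with h0 | h0
  · have h1 : 0 < -minkowski v v := by linarith
    have h3 := Real.sqrt_pos.2 h1
    have h4 := one_le_neg_minkowski ⟨(√(-minkowski v v))⁻¹ • (-1 : ℝ) • v, by
        have h2 := Real.sq_sqrt h1.le
        simp only [minkowski_smul_left, minkowski_smul_right]
        field_simp
        linarith, by
        have := mul_pos (inv_pos.2 h3) (neg_pos.2 h0)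
        simpa using this⟩ o
    simp only [minkowski_smul_left] at h4
    have h5 := mul_pos_of_neg_of_neg (neg_neg_of_pos (inv_pos.2 h3)) ho
    linarith
  · simp only [minkowski, h0] at h
    nlinarith [sq_nonneg (v 1), sq_nonneg (v 2), sq_nonneg (v 3)]

theorem smul_normalize {v : Fin 4 → ℝ} (o : Hyp3) (h : minkowski v v < 0)
    (ho : minkowski v o.coord < 0) :
    0 < √(-minkowski v v) ∧ √(-minkowski v v) ^ 2 = -minkowski v v ∧
      √(-minkowski v v) • (normalize v).coord = v := by
  have h1 : 0 < -minkowski v v := by linarith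
  have h3 := Real.sqrt_pos.2 h1
  refine ⟨h3, Real.sq_sqrt h1.le, ?_⟩
  rw [normalize, dif_pos ⟨h, zero_pos_of_timelike o h ho⟩, smul_smul, mul_inv_cancel₀ h3.ne',
    one_smul]

theorem normalize_coord {v : Fin 4 → ℝ} (o : Hyp3) (h : minkowski v v = -1)
    (ho : minkowski v o.coord < 0) : (normalize v).coord = v := by
  have := (smul_normalize o (by linarith) ho).2.2
  rwa [h, neg_neg, Real.sqrt_one, one_smul] at this

/-- A point of `ℍ³` in the cone spanned by `p` and `q` lies on the segment `[p, q]`. -/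
theorem mem_segment_of_coord_eq {p q w : Hyp3} {s t : ℝ} (hs : 0 ≤ s) (ht : 0 ≤ t)
    (h : w.coord = s • p.coord + t • q.coord) : w ∈ segment p q := by
  have hp := p.minkowski_self
  have hq := q.minkowski_self
  have hw := w.minkowski_self
  set c := minkowski p.coord q.coord with hc
  have hpw : minkowski p.coord w.coord = -s + t * c := by
    rw [h]; simp only [minkowski_add_right, minkowski_smul_right, hp, ← hc]; ring
  have hwq : minkowski w.coord q.coord = s * c - t := by
    rw [h]; simp only [minkowski_add_left, minkowski_smul_left, hq, ← hc]; ring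
  have hn : s ^ 2 + t ^ 2 - 2 * s * t * c = 1 := by
    rw [h] at hw
    simp only [minkowski_add_right, minkowski_smul_right, minkowski_add_left, minkowski_smul_left,
      hp, hq, minkowski_comm q.coord p.coord, ← hc] at hw
    linarith
  have hc1 := one_le_neg_minkowski p q
  rw [← hc] at hc1
  have s1 : Real.sinh (dist p w) = t * √(c ^ 2 - 1) := by
    rw [sinh_dist, hpw, show (-s + t * c) ^ 2 - 1 = t ^ 2 * (c ^ 2 - 1) by linear_combination hn,
      Real.sqrt_mul (sq_nonneg t), Real.sqrt_sq ht]
  have s2 : Real.sinh (dist w q) = s * √(c ^ 2 - 1) := by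
    rw [sinh_dist, hwq, show (s * c - t) ^ 2 - 1 = s ^ 2 * (c ^ 2 - 1) by linear_combination hn,
      Real.sqrt_mul (sq_nonneg s), Real.sqrt_sq hs]
  have hsq := Real.sq_sqrt (show 0 ≤ c ^ 2 - 1 by nlinarith)
  have key : Real.cosh (dist p w + dist w q) = Real.cosh (dist p q) := by
    rw [Real.cosh_add, s1, s2, cosh_dist, cosh_dist, cosh_dist, hpw, hwq, ← hc]
    linear_combination (-c) * hn + s * t * hsq
  exact Real.cosh_strictMonoOn.injOn (add_nonneg dist_nonneg dist_nonneg) dist_nonneg key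

theorem IsConvex.mem_of_coord_eq {K : Set Hyp3} (hK : IsConvex K) {p q w : Hyp3} (hp : p ∈ K)
    (hq : q ∈ K) {s t : ℝ} (hs : 0 ≤ s) (ht : 0 ≤ t)
    (h : w.coord = s • p.coord + t • q.coord) : w ∈ K :=
  hK p hp q hq (mem_segment_of_coord_eq hs ht h)

/-- The point at distance `t` from `o` in the direction of the unit tangent vector `e` at `o`. -/
noncomputable def ray (o : Hyp3) (e : Fin 4 → ℝ) (t : ℝ) : Hyp3 :=
  normalize (Real.cosh t • o.coord + Real.sinh t • e)

section ray
variable {o : Hyp3} {e : Fin 4 → ℝ}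

theorem ray_coord (he : minkowski o.coord e = 0) (h1 : minkowski e e = 1) (t : ℝ) :
    (ray o e t).coord = Real.cosh t • o.coord + Real.sinh t • e := by
  have ho := o.minkowski_self
  refine normalize_coord o ?_ ?_ <;>
  simp only [minkowski_add_right, minkowski_smul_right, minkowski_add_left, minkowski_smul_left,
      ho, minkowski_comm e o.coord, he, h1]
  · linarith [Real.cosh_sq t]
  · linarith [Real.cosh_pos t]

theorem ray_zero (he : minkowski o.coord e = 0) (h1 : minkowski e e = 1) : ray o e 0 = o := by
  ext1; rw [ray_coord he h1]; simp

/-- Points on spheres around `o`: the hyperbolic law of cosines. -/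
theorem minkowski_ray_ray {e' : Fin 4 → ℝ} (he : minkowski o.coord e = 0) (h1 : minkowski e e = 1)
    (he' : minkowski o.coord e' = 0) (h1' : minkowski e' e' = 1) (s t : ℝ) :
    -minkowski (ray o e s).coord (ray o e' t).coord =
      Real.cosh s * Real.cosh t - Real.sinh s * Real.sinh t * minkowski e e' := by
  have ho := o.minkowski_self
  rw [ray_coord he h1, ray_coord he' h1']
  simp only [minkowski_add_right, minkowski_smul_right, minkowski_add_left, minkowski_smul_left,
      ho, minkowski_comm e o.coord, he, he']
  ring

theorem isometry_ray (he : minkowski o.coord e = 0) (h1 : minkowski e e = 1) :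
    Isometry (ray o e) := by
  refine Isometry.of_dist_eq fun s t => ?_
  refine Real.cosh_strictMonoOn.injOn dist_nonneg dist_nonneg ?_
  rw [cosh_dist, minkowski_ray_ray he h1 he h1, h1, Real.dist_eq, Real.cosh_abs, Real.cosh_sub]
  ring

theorem dist_ray (he : minkowski o.coord e = 0) (h1 : minkowski e e = 1) (t : ℝ) :
    dist o (ray o e t) = |t| := by
  have := (isometry_ray he h1).dist_eq 0 t
  rwa [ray_zero he h1, Real.dist_eq, zero_sub, abs_neg] at this

end ray

/-- Any two different points are joined by a unit speed geodesic. -/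
theorem exists_ray {A B : Hyp3} (h : A ≠ B) :
    ∃ e, minkowski A.coord e = 0 ∧ minkowski e e = 1 ∧ ray A e (dist A B) = B := by
  have hA := A.minkowski_self
  have hB := B.minkowski_self
  have hd : 0 < Real.sinh (dist A B) := Real.sinh_pos_iff.2 (dist_pos.2 h)
  have hcosh := cosh_dist A B
  have hsq := Real.cosh_sq (dist A B)
  have he : minkowski A.coord ((Real.sinh (dist A B))⁻¹ •
      (B.coord - Real.cosh (dist A B) • A.coord)) = 0 := by
    simp only [minkowski_smul_right, minkowski_sub_right, hA, hcosh]; ring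
  have h1 : minkowski ((Real.sinh (dist A B))⁻¹ • (B.coord - Real.cosh (dist A B) • A.coord))
      ((Real.sinh (dist A B))⁻¹ • (B.coord - Real.cosh (dist A B) • A.coord)) = 1 := by
    simp only [minkowski_smul_left, minkowski_sub_left, minkowski_smul_right, minkowski_sub_right,
      hA, hB, minkowski_comm B.coord A.coord]
    rw [show minkowski A.coord B.coord = -Real.cosh (dist A B) by linarith]
    field_simp
    linarith
  refine ⟨_, he, h1, ?_⟩
  ext1
  rw [ray_coord he h1, smul_smul, mul_inv_cancel₀ hd.ne', one_smul]
  abel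

/-- The geodesic from `A` to `B`, parametrized proportionally to arc length on `[0, 1]`. -/
theorem exists_geodesic (A B : Hyp3) :
    ∃ γ : ℝ → Hyp3, LipschitzWith (nndist A B) γ ∧ γ 0 = A ∧ γ 1 = B ∧
      ∀ t ∈ Icc (0 : ℝ) 1, ∃ a b : ℝ, 0 ≤ a ∧ 0 ≤ b ∧
        (γ t).coord = a • A.coord + b • B.coord := by
  rcases eq_or_ne A B with rfl | h
  · exact ⟨fun _ => A, (LipschitzWith.const A).weaken zero_le, rfl, rfl,
      fun t _ => ⟨1, 0, zero_le_one, le_rfl, by simp⟩⟩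
  obtain ⟨e, he, h1, hB⟩ := exists_ray h
  refine ⟨fun t => ray A e (t * dist A B), ?_, by simp [ray_zero he h1], by simpa using hB, ?_⟩
  · refine LipschitzWith.of_dist_le_mul fun s t => ?_
    rw [(isometry_ray he h1).dist_eq, Real.dist_eq, Real.dist_eq, ← sub_mul, abs_mul, coe_nndist,
      abs_of_nonneg dist_nonneg, mul_comm]
  · intro t ht
    have hD := dist_pos.2 h
    have hd : 0 < Real.sinh (dist A B) := Real.sinh_pos_iff.2 hD
    refine ⟨Real.sinh ((1 - t) * dist A B) / Real.sinh (dist A B),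
      Real.sinh (t * dist A B) / Real.sinh (dist A B), ?_, ?_, ?_⟩
    · exact div_nonneg (Real.sinh_nonneg_iff.2 (mul_nonneg (by linarith [ht.2]) hD.le)) hd.le
    · exact div_nonneg (Real.sinh_nonneg_iff.2 (mul_nonneg ht.1 hD.le)) hd.le
    · have hBc : B.coord = Real.cosh (dist A B) • A.coord + Real.sinh (dist A B) • e := by
        rw [← ray_coord he h1, hB]
      rw [ray_coord he h1]
      set D := dist A B
      rw [hBc, show (1 - t) * D = D - t * D by ring, Real.sinh_sub]
      ext i
      simp only [Pi.add_apply, Pi.smul_apply, smul_eq_mul]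
      field_simp
      ring

/-! ### Nearest-point projection onto convex sets -/

/-- Cauchy–Schwarz in the tangent space of `ℍ³` at `p`. -/
theorem minkowski_sq_le_of_orthogonal (p : Hyp3) {u v : Fin 4 → ℝ} (hu : minkowski u p.coord = 0)
    (hv : minkowski v p.coord = 0) : minkowski u v ^ 2 ≤ minkowski u u * minkowski v v := by
  have key : ∀ s : ℝ, 0 ≤ minkowski u u * (s * s) + 2 * minkowski u v * s + minkowski v v := by
    intro s
    have h1 := minkowski_nonneg_of_orthogonal p (s • u + v) (by
      simp only [minkowski_add_left, minkowski_smul_left, hu, hv]; ring)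
    simp only [minkowski_add_left, minkowski_smul_left, minkowski_add_right, minkowski_smul_right,
      minkowski_comm v u] at h1
    linarith
  have hdisc := discrim_le_zero key
  unfold discrim at hdisc
  linarith

/-- A quadrilateral `x p q y` whose angles at `p` and `q` are at least right angles has
`d(p, q) ≤ d(x, y)`. The angle conditions are stated as Pythagorean inequalities. -/
theorem dist_le_of_obtuse {x y p q : Hyp3}
    (hx : minkowski x.coord p.coord * minkowski p.coord q.coord ≤ -minkowski x.coord q.coord)
    (hy : minkowski y.coord q.coord * minkowski p.coord q.coord ≤ -minkowski y.coord p.coord) :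
    dist p q ≤ dist x y := by
  refine dist_le_of_cosh_le dist_nonneg ?_
  rw [cosh_dist]
  have hxx := x.minkowski_self
  have hyy := y.minkowski_self
  have hpp := p.minkowski_self
  have hqq := q.minkowski_self
  have ha := one_le_neg_minkowski x p
  have hb := one_le_neg_minkowski y q
  have hc := one_le_neg_minkowski p q
  obtain ⟨a, ea⟩ : ∃ a, a = -minkowski x.coord p.coord := ⟨_, rfl⟩
  obtain ⟨b, eb⟩ : ∃ b, b = -minkowski y.coord q.coord := ⟨_, rfl⟩
  obtain ⟨c, ec⟩ : ∃ c, c = -minkowski p.coord q.coord := ⟨_, rfl⟩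
  have fa : minkowski x.coord p.coord = -a := by linarith
  have fb : minkowski y.coord q.coord = -b := by linarith
  have fc : minkowski p.coord q.coord = -c := by linarith
  have fc' : minkowski q.coord p.coord = -c := by rw [minkowski_comm]; exact fc
  rw [fa, fc] at hx
  rw [fb, fc] at hy
  rw [← ea] at ha
  rw [← eb] at hb
  rw [← ec] at hc ⊢
  rcases hc.eq_or_lt with hc1 | hc1
  · rw [← hc1]; exact one_le_neg_minkowski x y
  have hS : 0 < c ^ 2 - 1 := sub_pos.2 (one_lt_pow₀ hc1 two_ne_zero)
  -- `U` and `V` are the products of the tangential parts of `x` at `p` and of `y` at `q` with the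
  -- opposite foot point; removing the parts along `[p, q]` leaves `u` and `v`.
  obtain ⟨U, eU⟩ : ∃ U, U = minkowski x.coord q.coord + a * c := ⟨_, rfl⟩
  obtain ⟨V, eV⟩ : ∃ V, V = minkowski y.coord p.coord + b * c := ⟨_, rfl⟩
  have fU : minkowski x.coord q.coord = U - a * c := by linarith
  have fV : minkowski y.coord p.coord = V - b * c := by linarith
  have hU : U ≤ 0 := by linarith
  have hV : V ≤ 0 := by linarith
  have fy1 : minkowski p.coord y.coord = V - b * c := by rw [minkowski_comm]; exact fV
  have fy2 : minkowski q.coord y.coord = -b := by rw [minkowski_comm]; exact fb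
  have fx1 : minkowski p.coord x.coord = -a := by rw [minkowski_comm]; exact fa
  have fx2 : minkowski q.coord x.coord = U - a * c := by rw [minkowski_comm]; exact fU
  set u := x.coord - a • p.coord - (U / (c ^ 2 - 1)) • (q.coord - c • p.coord) with hu
  set v := y.coord - b • q.coord - (V / (c ^ 2 - 1)) • (p.coord - c • q.coord) with hv
  have up : minkowski u p.coord = 0 := by
    simp only [hu, minkowski_sub_left, minkowski_smul_left, fa, fc', hpp]; ring
  have vp : minkowski v p.coord = 0 := by
    simp only [hv, minkowski_sub_left, minkowski_smul_left, fV, fc', hpp]; field_simp; ring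
  have uu : minkowski u u = a ^ 2 - 1 - U ^ 2 / (c ^ 2 - 1) := by
    simp only [hu, minkowski_sub_left, minkowski_smul_left, minkowski_sub_right,
      minkowski_smul_right, hxx, fa, fU, fx1, fx2, fc, fc', hpp, hqq]
    field_simp; ring
  have vv : minkowski v v = b ^ 2 - 1 - V ^ 2 / (c ^ 2 - 1) := by
    simp only [hv, minkowski_sub_left, minkowski_smul_left, minkowski_sub_right,
      minkowski_smul_right, hyy, fb, fV, fy1, fy2, fc, fc', hpp, hqq]
    field_simp; ring
  have uv : minkowski u v = minkowski x.coord y.coord + a * b * c - a * V - b * U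
      + c * (U * V) / (c ^ 2 - 1) := by
    simp only [hu, hv, minkowski_sub_left, minkowski_smul_left, minkowski_sub_right,
      minkowski_smul_right, fa, fU, fy1, fy2, fc, fc', hpp, hqq]
    field_simp; ring
  have cs := minkowski_sq_le_of_orthogonal p up vp
  have h1 : minkowski u u ≤ a ^ 2 - 1 := by rw [uu]; linarith [div_nonneg (sq_nonneg U) hS.le]
  have h2 : minkowski v v ≤ b ^ 2 - 1 := by rw [vv]; linarith [div_nonneg (sq_nonneg V) hS.le]
  have h3 : minkowski u v ^ 2 ≤ (a * b - 1) ^ 2 := by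
    have := mul_le_mul h1 h2 (minkowski_nonneg_of_orthogonal p v vp)
      (sub_nonneg.2 (one_le_pow₀ ha))
    calc _ ≤ _ := cs
      _ ≤ _ := this
      _ ≤ _ := by linarith [sq_nonneg (a - b)]
  have hab : 1 ≤ a * b := one_le_mul_of_one_le_of_one_le ha hb
  have h4 : minkowski u v ≤ a * b - 1 := le_of_sq_le_sq h3 (by linarith)
  have h5 : 0 ≤ c * (U * V) / (c ^ 2 - 1) :=
    div_nonneg (mul_nonneg (by linarith) (mul_nonneg_of_nonpos_of_nonpos hU hV)) hS.le
  have h6 : a * V ≤ 0 := mul_nonpos_of_nonneg_of_nonpos (by linarith) hV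
  have h7 : b * U ≤ 0 := mul_nonpos_of_nonneg_of_nonpos (by linarith) hU
  linarith [mul_nonneg (sub_nonneg.2 hab) (sub_nonneg.2 hc)]

/-- At the point `p` of a convex set nearest to `x`, the angle between the directions to `x` and to
any other point `z` of the set is at least a right angle. -/
theorem IsConvex.obtuse_of_nearest {K : Set Hyp3} (hK : IsConvex K) {x p z : Hyp3} (hp : p ∈ K)
    (hmin : ∀ w ∈ K, dist x p ≤ dist x w) (hz : z ∈ K) :
    minkowski x.coord p.coord * minkowski p.coord z.coord ≤ -minkowski x.coord z.coord := by
  have hpp := p.minkowski_self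
  have hzz := z.minkowski_self
  have ha := one_le_neg_minkowski x p
  have hb := one_le_neg_minkowski x z
  have hc := one_le_neg_minkowski p z
  obtain ⟨a, ea⟩ : ∃ a, a = -minkowski x.coord p.coord := ⟨_, rfl⟩
  obtain ⟨b, eb⟩ : ∃ b, b = -minkowski x.coord z.coord := ⟨_, rfl⟩
  obtain ⟨c, ec⟩ : ∃ c, c = -minkowski p.coord z.coord := ⟨_, rfl⟩
  have fa : minkowski x.coord p.coord = -a := by linarith
  have fb : minkowski x.coord z.coord = -b := by linarith
  have fc : minkowski p.coord z.coord = -c := by linarith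
  rw [← ea] at ha
  rw [← eb] at hb
  rw [← ec] at hc
  rw [fa, fb, fc, neg_mul_neg, neg_neg]
  -- comparison of `x` with the points of `K` on the rays through `p + t z`
  have key : ∀ t : ℝ, 0 < t → 2 * a * (a * c - b) ≤ t * (b ^ 2 - a ^ 2) := by
    intro t ht
    have hvv : minkowski (p.coord + t • z.coord) (p.coord + t • z.coord)
        = -(1 + t ^ 2 + 2 * t * c) := by
      simp only [minkowski_add_left, minkowski_smul_left, minkowski_add_right,
        minkowski_smul_right, hpp, hzz, minkowski_comm z.coord p.coord, fc]
      ring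
    have hvp : minkowski (p.coord + t • z.coord) p.coord < 0 := by
      simp only [minkowski_add_left, minkowski_smul_left, hpp, minkowski_comm z.coord p.coord, fc]
      nlinarith
    obtain ⟨hN, hN2, hv⟩ := smul_normalize p (by rw [hvv]; nlinarith) hvp
    set w := normalize (p.coord + t • z.coord)
    set N := √(-minkowski (p.coord + t • z.coord) (p.coord + t • z.coord))
    have hwK : w ∈ K := by
      refine hK.mem_of_coord_eq hp hz (inv_nonneg.2 hN.le)
        (mul_nonneg (inv_nonneg.2 hN.le) ht.le) ?_
      rw [mul_smul, ← smul_add, ← hv, smul_smul, inv_mul_cancel₀ hN.ne', one_smul]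
    have h1 := neg_minkowski_le_cosh (hmin w hwK)
    rw [cosh_dist, fa, neg_neg] at h1
    have h2 : -(N * minkowski x.coord w.coord) = a + t * b := by
      rw [← minkowski_smul_right, hv, minkowski_add_right, minkowski_smul_right, fa, fb]; ring
    rw [hvv, neg_neg] at hN2
    have h3 : a * N ≤ a + t * b := by nlinarith
    have h4 : (a * N) ^ 2 ≤ (a + t * b) ^ 2 := pow_le_pow_left₀ (by positivity) h3 2
    rw [mul_pow, hN2] at h4
    have h5 : t * (2 * a * (a * c - b)) ≤ t * (t * (b ^ 2 - a ^ 2)) := by nlinarith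
    exact le_of_mul_le_mul_left h5 ht
  have hlim : Tendsto (fun t : ℝ => t * (b ^ 2 - a ^ 2)) (𝓝[>] 0) (𝓝 0) := by
    have : Tendsto (fun t : ℝ => t * (b ^ 2 - a ^ 2)) (𝓝 0) (𝓝 (0 * (b ^ 2 - a ^ 2))) :=
      tendsto_id.mul_const _
    rw [zero_mul] at this
    exact this.mono_left nhdsWithin_le_nhds
  have h6 : 2 * a * (a * c - b) ≤ 0 :=
    ge_of_tendsto hlim (eventually_nhdsWithin_of_forall fun t ht => key t ht)
  nlinarith

/-- The nearest-point projection onto a compact convex set is `1`-Lipschitz, and it maps the points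
outside the interior to the boundary. -/
theorem IsConvex.exists_projection {K : Set Hyp3} (hK : IsConvex K) (hc : IsCompact K)
    (hne : K.Nonempty) :
    ∃ P : Hyp3 → Hyp3, LipschitzWith 1 P ∧ (∀ x ∈ K, P x = x) ∧
      ∀ x ∉ interior K, P x ∈ frontier K := by
  choose P hPK hP using fun x => hc.exists_infDist_eq_dist hne x
  have hmin : ∀ x, ∀ w ∈ K, dist x (P x) ≤ dist x w := fun x w hw => by
    rw [← hP x]; exact Metric.infDist_le_dist_of_mem hw
  have hfix : ∀ x ∈ K, P x = x := fun x hx => by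
    have := hmin x x hx
    rw [dist_self] at this
    exact (dist_le_zero.1 this).symm
  refine ⟨P, ?_, hfix, ?_⟩
  · refine LipschitzWith.mk_one fun x y => ?_
    refine dist_le_of_obtuse (hK.obtuse_of_nearest (hPK x) (hmin x) (hPK y)) ?_
    rw [minkowski_comm (P x).coord]
    exact hK.obtuse_of_nearest (hPK y) (hmin y) (hPK x)
  · intro x hx
    rw [hc.isClosed.frontier_eq]
    refine ⟨hPK x, fun hint => ?_⟩
    have hne : P x ≠ x := fun h => hx (h ▸ hint)
    have hpos := dist_pos.2 hne
    -- a point of `K` on the way from `P x` to `x` would be nearer to `x`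
    obtain ⟨γ, hγ, h0, h1, -⟩ := exists_geodesic (P x) x
    have hnear : ∀ᶠ t in 𝓝[>] (0 : ℝ), γ t ∈ K := by
      refine (hγ.continuous.continuousAt.eventually ?_).filter_mono nhdsWithin_le_nhds
      rw [h0]; exact mem_interior_iff_mem_nhds.1 hint
    obtain ⟨t, htK, ht⟩ := (hnear.and (Ioo_mem_nhdsGT zero_lt_one)).exists
    have h2 := hγ.dist_le_mul 1 t
    rw [h1, Real.dist_eq, abs_of_pos (by linarith [ht.2]), coe_nndist] at h2
    have h3 := hmin x _ htK
    rw [dist_comm x (P x)] at h3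
    nlinarith [ht.1]

/-! ### Pushing away from an interior point -/

theorem mul_sinh_le_sinh_mul {s x : ℝ} (hs : 1 ≤ s) (hx : 0 ≤ x) :
    s * Real.sinh x ≤ Real.sinh (s * x) := by
  have hderiv : ∀ y : ℝ, HasDerivAt (fun y => Real.sinh (s * y) - s * Real.sinh y)
      (Real.cosh (s * y) * s - s * Real.cosh y) y := fun y => by
    have h1 : HasDerivAt (fun y => s * y) s y := by simpa using (hasDerivAt_id y).const_mul s
    exact h1.sinh.sub ((Real.hasDerivAt_sinh y).const_mul s)
  have hmono : MonotoneOn (fun y => Real.sinh (s * y) - s * Real.sinh y) (Ici 0) := by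
    refine monotoneOn_of_deriv_nonneg (convex_Ici 0)
      (fun y _ => (hderiv y).continuousAt.continuousWithinAt)
      (fun y _ => (hderiv y).differentiableAt.differentiableWithinAt) fun y hy => ?_
    rw [interior_Ici, mem_Ioi] at hy
    have h2 : Real.cosh y ≤ Real.cosh (s * y) := by
      rw [Real.cosh_le_cosh, abs_of_pos hy, abs_of_pos (by positivity)]
      nlinarith
    rw [(hderiv y).deriv]
    nlinarith
  have := hmono (mem_Ici.2 le_rfl) (mem_Ici.2 hx) hx
  simp only [mul_zero, Real.sinh_zero, sub_zero] at this
  linarith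

theorem cosh_sub_one (x : ℝ) : Real.cosh x - 1 = 2 * Real.sinh (x / 2) ^ 2 := by
  have h := Real.cosh_two_mul (x / 2)
  rw [mul_div_cancel₀ x two_ne_zero, Real.cosh_sq] at h
  linarith

/-- A Lipschitz bound for `√(cosh d - 1)` with a constant `s ≥ 1` implies the same one for `d`,
because `cosh (s d) - 1 ≥ s² (cosh d - 1)`. -/
theorem dist_le_mul_dist {x y x' y' : Hyp3} {s : ℝ} (hs : 1 ≤ s)
    (h : -minkowski x'.coord y'.coord - 1 ≤ s ^ 2 * (-minkowski x.coord y.coord - 1)) :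
    dist x' y' ≤ s * dist x y := by
  have hd : 0 ≤ dist x y := dist_nonneg
  refine dist_le_of_cosh_le (by positivity) ?_
  rw [← cosh_dist x y, cosh_sub_one] at h
  have h1 := mul_sinh_le_sinh_mul hs (div_nonneg hd zero_le_two)
  have h2 := cosh_sub_one (s * dist x y)
  have h3 : 0 ≤ Real.sinh (dist x y / 2) := Real.sinh_nonneg_iff.2 (by linarith)
  have h4 : (s * Real.sinh (dist x y / 2)) ^ 2 ≤ Real.sinh (s * (dist x y / 2)) ^ 2 :=
    pow_le_pow_left₀ (by positivity) h1 2
  rw [mul_div_assoc] at h2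
  nlinarith

/-- The map `f` that pushes the points `x` with `cosh d(o, x) ≤ M` away from `o`: in the projective
model with centre `o` it is the homothety with a ratio slightly above `1`. It distorts distances
from above only by the factor `1 + e`. -/
theorem exists_push (o : Hyp3) {M e : ℝ} (hM : 1 ≤ M) (he : 0 < e) :
    ∃ (κ : ℝ) (f : Hyp3 → Hyp3), 0 < κ ∧
      (∀ x, -minkowski o.coord x.coord ≤ M →
        (∃ N : ℝ, 0 < N ∧
          x.coord = (κ * -minkowski o.coord x.coord) • o.coord + N • (f x).coord) ∧
        dist x (f x) ≤ e) ∧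
      ∀ x y, -minkowski o.coord x.coord ≤ M → -minkowski o.coord y.coord ≤ M →
        dist (f x) (f y) ≤ (1 + e) * dist x y := by
  -- `σ` bounds the relative change `τ a²` of the norm; `1 / (1 - σ) = 1 + e` is the distortion
  obtain ⟨σ, eσ⟩ : ∃ σ, σ = e / (1 + e) := ⟨_, rfl⟩
  have hσ0 : 0 < σ := by rw [eσ]; positivity
  have hσ : (1 - σ) * (1 + e) = 1 := by rw [eσ]; field_simp; ring
  have hσ1 : 0 < 1 - σ := by
    by_contra! h; nlinarith
  obtain ⟨κ, eκ⟩ : ∃ κ, κ = σ / (2 * M ^ 2) := ⟨_, rfl⟩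
  have hκ0 : 0 < κ := by rw [eκ]; positivity
  have hκM : 2 * κ * M ^ 2 = σ := by rw [eκ]; field_simp
  have hκ1 : κ < 1 := by nlinarith
  -- the push contracts the coordinate along `o` by `1 - κ`, its square by `1 - τ`
  obtain ⟨τ, eτ⟩ : ∃ τ, τ = 2 * κ - κ ^ 2 := ⟨_, rfl⟩
  have hτ0 : 0 < τ := by nlinarith
  have hτM : τ * M ^ 2 ≤ σ := by
    rw [← hκM, eτ]; exact mul_le_mul_of_nonneg_right (by nlinarith) (sq_nonneg M)
  have hoo := o.minkowski_self
  set f : Hyp3 → Hyp3 := fun x =>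
    normalize (x.coord + (κ * minkowski o.coord x.coord) • o.coord) with hf
  -- the normalizing factor of `f`
  have spec : ∀ x : Hyp3, -minkowski o.coord x.coord ≤ M → ∃ N : ℝ, 0 < N ∧
      N ^ 2 = 1 - τ * minkowski o.coord x.coord ^ 2 ∧ 1 - σ ≤ N ^ 2 ∧
      N • (f x).coord = x.coord + (κ * minkowski o.coord x.coord) • o.coord := by
    intro x hx
    have ha := one_le_neg_minkowski o x
    have hxx := x.minkowski_self
    obtain ⟨a, ea⟩ : ∃ a, a = -minkowski o.coord x.coord := ⟨_, rfl⟩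
    have fa : minkowski o.coord x.coord = -a := by linarith
    rw [← ea] at ha hx
    have hvv : minkowski (x.coord + (κ * minkowski o.coord x.coord) • o.coord)
        (x.coord + (κ * minkowski o.coord x.coord) • o.coord) = -(1 - τ * a ^ 2) := by
      simp only [minkowski_add_left, minkowski_smul_left, minkowski_add_right,
        minkowski_smul_right, hoo, hxx, minkowski_comm x.coord o.coord, fa, eτ]
      ring
    have hvo : minkowski (x.coord + (κ * minkowski o.coord x.coord) • o.coord) o.coord < 0 := by
      simp only [minkowski_add_left, minkowski_smul_left, hoo, minkowski_comm x.coord o.coord, fa]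
      nlinarith
    have h1 : τ * a ^ 2 ≤ σ :=
      (mul_le_mul_of_nonneg_left (pow_le_pow_left₀ (by linarith) hx 2) hτ0.le).trans hτM
    obtain ⟨hN, hN2, hv⟩ := smul_normalize o (by rw [hvv]; linarith) hvo
    refine ⟨_, hN, ?_, ?_, hv⟩
    · rw [hN2, hvv, fa]; ring
    · rw [hN2, hvv]; linarith
  refine ⟨κ, f, hκ0, fun x hx => ?_, fun x y hx hy => ?_⟩
  · obtain ⟨N, hN, hN2, hNσ, hv⟩ := spec x hx
    have ha := one_le_neg_minkowski o x
    have hxx := x.minkowski_self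
    refine ⟨⟨N, hN, by rw [hv]; module⟩, dist_le_of_sq_le he.le ?_⟩
    obtain ⟨a, ea⟩ : ∃ a, a = -minkowski o.coord x.coord := ⟨_, rfl⟩
    have fa : minkowski o.coord x.coord = -a := by linarith
    rw [← ea] at ha hx
    have h1 : N * minkowski x.coord (f x).coord = -(1 - κ * a ^ 2) := by
      rw [← minkowski_smul_right, hv]
      simp only [minkowski_add_right, minkowski_smul_right, hxx, minkowski_comm x.coord o.coord, fa]
      ring
    have h2 : N ^ 2 * (minkowski x.coord (f x).coord ^ 2 - 1) = κ ^ 2 * a ^ 2 * (a ^ 2 - 1) := by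
      rw [mul_sub, ← mul_pow, h1, hN2, fa, eτ]; ring
    have h3 : κ ^ 2 * a ^ 2 * (a ^ 2 - 1) ≤ σ ^ 2 := by
      have h4 : κ * a ^ 2 ≤ σ := by
        have : κ * a ^ 2 ≤ κ * M ^ 2 :=
          mul_le_mul_of_nonneg_left (pow_le_pow_left₀ (by linarith) hx 2) hκ0.le
        linarith
      have h5 : (κ * a ^ 2) ^ 2 ≤ σ ^ 2 := pow_le_pow_left₀ (by positivity) h4 2
      nlinarith [sq_nonneg (κ * a)]
    have h6 : N ^ 2 * e ^ 2 ≥ σ ^ 2 := by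
      have h7 : σ = (1 - σ) * e := by linarith
      have h8 : σ ^ 2 = (1 - σ) ^ 2 * e ^ 2 := by rw [← mul_pow, ← h7]
      rw [h8]
      exact mul_le_mul_of_nonneg_right (by nlinarith) (sq_nonneg e)
    have hNpos : 0 < N ^ 2 := by positivity
    exact le_of_mul_le_mul_left (by linarith) hNpos
  · refine dist_le_mul_dist (by linarith) ?_
    obtain ⟨N₁, hN₁, hN₁2, hN₁σ, hv₁⟩ := spec x hx
    obtain ⟨N₂, hN₂, hN₂2, hN₂σ, hv₂⟩ := spec y hy
    have ha := one_le_neg_minkowski o x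
    have hb := one_le_neg_minkowski o y
    have hC := one_le_neg_minkowski x y
    have hgram := gram_le o x y
    obtain ⟨a, ea⟩ : ∃ a, a = -minkowski o.coord x.coord := ⟨_, rfl⟩
    obtain ⟨b, eb⟩ : ∃ b, b = -minkowski o.coord y.coord := ⟨_, rfl⟩
    obtain ⟨C, eC⟩ : ∃ C, C = -minkowski x.coord y.coord := ⟨_, rfl⟩
    obtain ⟨D, eD⟩ : ∃ D, D = -minkowski (f x).coord (f y).coord := ⟨_, rfl⟩
    have fa : minkowski o.coord x.coord = -a := by linarith
    have fb : minkowski o.coord y.coord = -b := by linarith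
    have fC : minkowski x.coord y.coord = -C := by linarith
    have hD : N₁ * N₂ * D = C - τ * (a * b) := by
      have : N₁ * N₂ * D = -minkowski (N₁ • (f x).coord) (N₂ • (f y).coord) := by
        rw [minkowski_smul_left, minkowski_smul_right, eD]; ring
      rw [this, hv₁, hv₂]
      simp only [minkowski_add_left, minkowski_smul_left, minkowski_add_right,
        minkowski_smul_right, hoo, minkowski_comm x.coord o.coord, fa, fb, fC, eτ]
      ring
    rw [← ea] at ha hx
    rw [← eb] at hb hy
    rw [fa, fb, ← eC] at hgram
    rw [← eC] at hC ⊢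
    rw [← eD]
    rw [fa] at hN₁2
    rw [fb] at hN₂2
    clear eD eC eb ea fa fb fC hv₁ hv₂ spec hf eκ eσ
    obtain ⟨N, eN⟩ : ∃ N, N = N₁ * N₂ := ⟨_, rfl⟩
    have hN0 : 0 < N := by rw [eN]; positivity
    have hN2 : N ^ 2 = (1 - τ * a ^ 2) * (1 - τ * b ^ 2) := by
      rw [eN, mul_pow, hN₁2, hN₂2]; ring
    have hN : 1 - σ ≤ N := by
      refine le_of_sq_le_sq ?_ hN0.le
      rw [eN, mul_pow, sq (1 - σ)]
      exact mul_le_mul hN₁σ hN₂σ hσ1.le (sq_nonneg _)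
    rw [← eN] at hD
    have hab : τ * (a * b) ≤ σ := by
      have : a * b ≤ M ^ 2 := by rw [sq]; exact mul_le_mul hx hy (by linarith) (by linarith)
      exact (mul_le_mul_of_nonneg_left this hτ0.le).trans hτM
    -- `1 - τ a b` and `N` differ by a quantity of the order of `τ (a - b) ^ 2`
    have h1 : (1 - τ * (a * b) - N) * (1 - τ * (a * b) + N) = τ * (a - b) ^ 2 := by
      linear_combination -hN2
    have h2 : τ * (a - b) ^ 2 ≤ 2 * σ * (C - 1) := by
      have h3 : τ * (a - b) ^ 2 ≤ τ * (2 * (a * b) * (C - 1)) :=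
        mul_le_mul_of_nonneg_left (by linarith) hτ0.le
      have h4 : τ * (a * b) * (2 * (C - 1)) ≤ σ * (2 * (C - 1)) :=
        mul_le_mul_of_nonneg_right hab (by linarith)
      linarith
    have h5 : 0 ≤ 1 - τ * (a * b) - N := by
      by_contra! h
      have := mul_neg_of_neg_of_pos h (show 0 < 1 - τ * (a * b) + N by linarith)
      linarith [mul_nonneg hτ0.le (sq_nonneg (a - b))]
    have h6 : (1 - τ * (a * b) - N) * (1 - σ) ≤ σ * (C - 1) := by
      have := mul_le_mul_of_nonneg_left
        (show 2 * (1 - σ) ≤ 1 - τ * (a * b) + N by linarith) h5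
      linarith
    have h7 : (1 - σ) * (N * (D - 1)) ≤ C - 1 := by
      rw [show N * (D - 1) = C - 1 + (1 - τ * (a * b) - N) by linarith]
      linarith
    have h8 : N * (D - 1) ≤ (1 + e) * (C - 1) := by
      have := mul_le_mul_of_nonneg_left h7 (show 0 ≤ 1 + e by linarith)
      rwa [← mul_assoc, mul_comm (1 + e), hσ, one_mul] at this
    rcases le_total D 1 with hD1 | hD1
    · exact (sub_nonpos.2 hD1).trans (mul_nonneg (sq_nonneg _) (by linarith))
    · have h9 : (1 - σ) * (D - 1) ≤ (1 + e) * (C - 1) :=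
        (mul_le_mul_of_nonneg_right hN (by linarith)).trans h8
      have := mul_le_mul_of_nonneg_left h9 (show 0 ≤ 1 + e by linarith)
      rw [← mul_assoc, mul_comm (1 + e), hσ, one_mul] at this
      linarith

/-- If a convex set contains the ball `B(o, r)` and the point `y`, then each point
`x = s o + t y` of their cone with `s > 0` is interior; the radius of a ball around `x` in the set
depends only on `r`, a lower bound `κ` of `s` and a bound `R` of the distance from `o`. -/
theorem exists_ball_subset (o : Hyp3) {r R κ : ℝ} (hr : 0 < r) (hκ : 0 < κ) :
    ∃ δ > 0, ∀ K : Set Hyp3, IsConvex K → Metric.ball o r ⊆ K →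
      ∀ x y : Hyp3, y ∈ K → dist o x ≤ R →
      (∃ s t : ℝ, κ ≤ s ∧ 0 ≤ t ∧ x.coord = s • o.coord + t • y.coord) →
      Metric.ball x δ ⊆ K := by
  obtain ⟨M, eM⟩ : ∃ M, M = Real.cosh (R + 1) := ⟨_, rfl⟩
  have hM : 1 ≤ M := by rw [eM]; exact Real.one_le_cosh _
  -- `η` is small enough for `o' ∝ s o + (w - x)` below to be timelike and within `r` of `o`
  obtain ⟨η, hη0, hη1, hη2⟩ : ∃ η : ℝ, 0 < η ∧ (2 * M ^ 2 + 2) * η ≤ κ ^ 2 / 16 ∧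
      (2 * M ^ 2 + 2) * η < r ^ 2 * (κ ^ 2 / 4) := by
    have h1 : 0 < min (κ ^ 2 / 16) (r ^ 2 * (κ ^ 2 / 4)) := by positivity
    refine ⟨min (κ ^ 2 / 16) (r ^ 2 * (κ ^ 2 / 4)) / (2 * (2 * M ^ 2 + 2)), by positivity, ?_⟩
    rw [show (2 * M ^ 2 + 2) * (min (κ ^ 2 / 16) (r ^ 2 * (κ ^ 2 / 4)) / (2 * (2 * M ^ 2 + 2)))
      = min (κ ^ 2 / 16) (r ^ 2 * (κ ^ 2 / 4)) / 2 by field_simp]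
    have h2 := min_le_left (κ ^ 2 / 16) (r ^ 2 * (κ ^ 2 / 4))
    have h3 := min_le_right (κ ^ 2 / 16) (r ^ 2 * (κ ^ 2 / 4))
    constructor <;> linarith
  obtain ⟨δ, hδ0, hδ1, hδη⟩ : ∃ δ : ℝ, 0 < δ ∧ δ ≤ 1 ∧ Real.cosh δ ≤ 1 + η := by
    have h1 : ∀ᶠ t in 𝓝[>] (0 : ℝ), Real.cosh t < 1 + η := by
      refine (Real.continuous_cosh.continuousAt.eventually_lt_const ?_).filter_mono
        nhdsWithin_le_nhds
      rw [Real.cosh_zero]; linarith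
    obtain ⟨t, h2, h3⟩ := (h1.and (Ioo_mem_nhdsGT zero_lt_one)).exists
    exact ⟨t, h3.1, h3.2.le, h2.le⟩
  refine ⟨δ, hδ0, fun K hK hball x y hy hx hst w hw => ?_⟩
  obtain ⟨s, t, hs, ht, hxst⟩ := hst
  rw [Metric.mem_ball, dist_comm] at hw
  have hoo := o.minkowski_self
  have hxx := x.minkowski_self
  have hww := w.minkowski_self
  have ha := one_le_neg_minkowski o x
  have hb := one_le_neg_minkowski o w
  have hC := one_le_neg_minkowski x w
  have hCη : -minkowski x.coord w.coord ≤ 1 + η := (neg_minkowski_le_cosh hw.le).trans hδη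
  have hgram := gram_le o x w
  have haM : -minkowski o.coord x.coord ≤ M := by
    rw [eM]; exact neg_minkowski_le_cosh (by linarith)
  have hbM : -minkowski o.coord w.coord ≤ M := by
    rw [eM]; exact neg_minkowski_le_cosh (by linarith [dist_triangle o x w])
  obtain ⟨a, ea⟩ : ∃ a, a = -minkowski o.coord x.coord := ⟨_, rfl⟩
  obtain ⟨b, eb⟩ : ∃ b, b = -minkowski o.coord w.coord := ⟨_, rfl⟩
  obtain ⟨C, eC⟩ : ∃ C, C = -minkowski x.coord w.coord := ⟨_, rfl⟩
  have fa : minkowski o.coord x.coord = -a := by linarith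
  have fb : minkowski o.coord w.coord = -b := by linarith
  have fC : minkowski x.coord w.coord = -C := by linarith
  rw [fa, fb, ← eC] at hgram
  rw [← ea] at ha haM
  rw [← eb] at hb hbM
  rw [← eC] at hC hCη
  -- `w` lies in the cone over `y` and a point `o'` on the ray through `s o + (w - x)`
  have hvv : minkowski (s • o.coord + (w.coord - x.coord)) (s • o.coord + (w.coord - x.coord))
      = -(s ^ 2 + 2 * s * (b - a) - 2 * (C - 1)) := by
    simp only [minkowski_add_left, minkowski_smul_left, minkowski_add_right,
      minkowski_smul_right, minkowski_sub_left, minkowski_sub_right, hoo, hxx, hww,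
      minkowski_comm x.coord o.coord, minkowski_comm w.coord o.coord,
      minkowski_comm w.coord x.coord, fa, fb, fC]
    ring
  have hov : minkowski (s • o.coord + (w.coord - x.coord)) o.coord = -(s + (b - a)) := by
    simp only [minkowski_add_left, minkowski_smul_left, minkowski_sub_left, hoo,
      minkowski_comm x.coord o.coord, minkowski_comm w.coord o.coord, fa, fb]
    ring
  have hs0 : 0 < s := hκ.trans_le hs
  have hβ2 : (b - a) ^ 2 + 2 * (C - 1) ≤ (2 * M ^ 2 + 2) * η := by
    have h1 : a * b ≤ M ^ 2 := by rw [sq]; exact mul_le_mul haM hbM (by linarith) (by linarith)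
    have h2 : a * b * (C - 1) ≤ M ^ 2 * η :=
      mul_le_mul h1 (by linarith) (by linarith) (sq_nonneg M)
    linarith
  have hβ : |b - a| ≤ κ / 4 := by
    refine abs_le_of_sq_le_sq ?_ (by positivity)
    linarith
  have hβ' := abs_le.1 hβ
  have hq : κ ^ 2 / 4 ≤ s ^ 2 + 2 * s * (b - a) - 2 * (C - 1) := by
    have h1 : -(κ / 4) * s ≤ (b - a) * s := mul_le_mul_of_nonneg_right hβ'.1 hs0.le
    have h2 : κ * s ≤ s * s := mul_le_mul_of_nonneg_right hs hs0.le
    have h3 : κ * κ ≤ s * κ := mul_le_mul_of_nonneg_right hs hκ.le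
    linarith [sq_nonneg (b - a)]
  have hκ2 : 0 < κ ^ 2 := by positivity
  obtain ⟨hN, hN2, hv⟩ := smul_normalize o (v := s • o.coord + (w.coord - x.coord))
    (by rw [hvv]; linarith) (by rw [hov]; linarith)
  set o' := normalize (s • o.coord + (w.coord - x.coord))
  set N := √(-minkowski (s • o.coord + (w.coord - x.coord))
    (s • o.coord + (w.coord - x.coord)))
  rw [hvv, neg_neg] at hN2
  have ho' : o' ∈ Metric.ball o r := by
    rw [Metric.mem_ball, dist_comm]
    have h1 : N * minkowski o.coord o'.coord = -(s + (b - a)) := by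
      rw [← minkowski_smul_right, hv, minkowski_comm, hov]
    have h2 : N ^ 2 * (minkowski o.coord o'.coord ^ 2 - 1) = (b - a) ^ 2 + 2 * (C - 1) := by
      rw [mul_sub, ← mul_pow, h1, hN2]; ring
    have h3 : minkowski o.coord o'.coord ^ 2 - 1 < r ^ 2 := by
      have h4 : N ^ 2 * (minkowski o.coord o'.coord ^ 2 - 1) < N ^ 2 * r ^ 2 := by
        have : r ^ 2 * (κ ^ 2 / 4) ≤ r ^ 2 * N ^ 2 :=
          mul_le_mul_of_nonneg_left (by linarith) (sq_nonneg r)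
        linarith
      exact lt_of_mul_lt_mul_left h4 (sq_nonneg N)
    have h5 : Real.sinh (dist o o') < r := by
      rw [sinh_dist]
      exact (Real.sqrt_lt' hr).2 h3
    exact (Real.self_le_sinh_iff.2 dist_nonneg).trans_lt h5
  refine hK.mem_of_coord_eq (hball ho') hy hN.le ht ?_
  rw [hv, ← sub_eq_iff_eq_add'.2 hxst]
  abel

/-! ### Intrinsic distances -/

theorem intrinsicDist_le_curveLength {F : Set Hyp3} {X Y : Hyp3} {γ : ℝ → Hyp3}
    (h : IsCurveIn F X Y γ) : intrinsicDist F X Y ≤ curveLength γ :=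
  iInf₂_le γ h

theorem intrinsicDist_anti {F G : Set Hyp3} (h : F ⊆ G) (X Y : Hyp3) :
    intrinsicDist G X Y ≤ intrinsicDist F X Y :=
  le_iInf₂ fun _ hγ =>
    intrinsicDist_le_curveLength ⟨hγ.1, hγ.2.1.mono_right h, hγ.2.2.1, hγ.2.2.2⟩

/-- Intrinsic distances under Lipschitz maps. -/
theorem intrinsicDist_map_le {F G : Set Hyp3} {f : Hyp3 → Hyp3} {L : NNReal}
    (hL : L ≠ 0) (hf : LipschitzOnWith L f F) (hFG : MapsTo f F G) (X Y : Hyp3) :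
    intrinsicDist G (f X) (f Y) ≤ L * intrinsicDist F X Y := by
  have hL' : (L : ℝ≥0∞) ≠ 0 := ENNReal.coe_ne_zero.2 hL
  simp only [intrinsicDist, ENNReal.mul_iInf_of_ne hL' ENNReal.coe_ne_top]
  refine le_iInf₂ fun γ hγ => ?_
  exact (intrinsicDist_le_curveLength ⟨hf.continuousOn.comp hγ.1 hγ.2.1, hFG.comp hγ.2.1,
    congrArg f hγ.2.2.1, congrArg f hγ.2.2.2⟩).trans (hf.comp_eVariationOn_le hγ.2.1)

theorem intrinsicDist_comm_le (F : Set Hyp3) (X Y : Hyp3) :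
    intrinsicDist F X Y ≤ intrinsicDist F Y X := by
  refine le_iInf₂ fun γ hγ => ?_
  have hm : MapsTo (fun t : ℝ => 1 - t) (Icc 0 1) (Icc 0 1) := fun t ht =>
    ⟨by linarith [ht.2], by linarith [ht.1]⟩
  refine (intrinsicDist_le_curveLength (γ := γ ∘ fun t => 1 - t)
    ⟨hγ.1.comp (by fun_prop) hm, hγ.2.1.comp hm, ?_, ?_⟩).trans
    (eVariationOn.comp_le_of_antitoneOn γ _ (fun a _ b _ hab => sub_le_sub_left hab 1) hm)
  · simpa using hγ.2.2.2
  · simpa using hγ.2.2.1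

theorem intrinsicDist_comm (F : Set Hyp3) (X Y : Hyp3) :
    intrinsicDist F X Y = intrinsicDist F Y X :=
  le_antisymm (intrinsicDist_comm_le F X Y) (intrinsicDist_comm_le F Y X)

theorem intrinsicDist_triangle (F : Set Hyp3) (X Y Z : Hyp3) :
    intrinsicDist F X Z ≤ intrinsicDist F X Y + intrinsicDist F Y Z := by
  refine ENNReal.le_iInf₂_add_iInf₂ fun γ₁ h₁ γ₂ h₂ => ?_
  have hhalf : ∀ t ∈ Icc (1 / 2 : ℝ) 1,
      (if t ≤ 1 / 2 then γ₁ (2 * t) else γ₂ (2 * t - 1)) = γ₂ (2 * t - 1) := by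
    intro t ht
    split_ifs with h
    · rw [le_antisymm h ht.1]; norm_num [h₁.2.2.2, h₂.2.2.1]
    · rfl
  have hhalf' : ∀ t ∈ Icc (0 : ℝ) (1 / 2),
      (if t ≤ 1 / 2 then γ₁ (2 * t) else γ₂ (2 * t - 1)) = γ₁ (2 * t) := fun t ht =>
    if_pos ht.2
  have m₁ : MapsTo (fun t : ℝ => 2 * t) (Icc 0 (1 / 2)) (Icc 0 1) := fun t ht =>
    ⟨by linarith [ht.1], by linarith [ht.2]⟩
  have m₂ : MapsTo (fun t : ℝ => 2 * t - 1) (Icc (1 / 2) 1) (Icc 0 1) := fun t ht =>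
    ⟨by linarith [ht.1], by linarith [ht.2]⟩
  have hun : Icc (0 : ℝ) (1 / 2) ∪ Icc (1 / 2) 1 = Icc 0 1 :=
    Icc_union_Icc_eq_Icc (by norm_num) (by norm_num)
  refine (intrinsicDist_le_curveLength
    (γ := fun t => if t ≤ 1 / 2 then γ₁ (2 * t) else γ₂ (2 * t - 1))
    ⟨?_, ?_, ?_, ?_⟩).trans ?_
  · rw [← hun]
    refine ContinuousOn.union_of_isClosed ?_ ?_ isClosed_Icc isClosed_Icc
    · exact (h₁.1.comp (by fun_prop) m₁).congr hhalf'
    · exact (h₂.1.comp (by fun_prop) m₂).congr hhalf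
  · rw [← hun]
    rintro t (ht | ht)
    · simp only [hhalf' t ht]; exact h₁.2.1 (m₁ ht)
    · simp only [hhalf t ht]; exact h₂.2.1 (m₂ ht)
  · norm_num [h₁.2.2.1]
  · norm_num [h₂.2.2.2]
  · have h := eVariationOn.Icc_add_Icc (fun t => if t ≤ 1 / 2 then γ₁ (2 * t) else γ₂ (2 * t - 1))
      (s := univ) (a := (0 : ℝ)) (b := 1 / 2) (c := 1) (by norm_num) (by norm_num) trivial
    simp only [univ_inter] at h
    rw [curveLength, ← h, eVariationOn.congr hhalf', eVariationOn.congr hhalf]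
    refine add_le_add ?_ ?_
    · exact eVariationOn.comp_le_of_monotoneOn γ₁ _ (fun a _ b _ hab => by simpa using hab) m₁
    · exact eVariationOn.comp_le_of_monotoneOn γ₂ _ (fun a _ b _ hab => by simpa using hab) m₂

/-- A Lipschitz curve bounds the intrinsic distance of its end points by its constant. -/
theorem intrinsicDist_le_of_lipschitz {F : Set Hyp3} {γ : ℝ → Hyp3} {L : NNReal}
    (hγ : LipschitzWith L γ) (hF : MapsTo γ (Icc 0 1) F) :
    intrinsicDist F (γ 0) (γ 1) ≤ L := by
  refine (intrinsicDist_le_curveLength ⟨hγ.continuous.continuousOn, hF, rfl, rfl⟩).trans ?_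
  have h1 := (hγ.lipschitzOnWith (s := Icc (0 : ℝ) 1)).comp_eVariationOn_le (g := id)
    (s := Icc (0 : ℝ) 1) (fun _ h => h)
  have h2 := (monotoneOn_id (s := Icc (0 : ℝ) 1)).eVariationOn_eq
    (left_mem_Icc.2 zero_le_one) (right_mem_Icc.2 zero_le_one)
  rw [inter_self] at h2
  refine h1.trans ((mul_le_mul_right h2.le _).trans_eq ?_)
  simp

theorem intrinsicDist_le_edist_of_segment {F : Set Hyp3} {A B : Hyp3}
    (h : ∀ (x : Hyp3) (a b : ℝ), 0 ≤ a → 0 ≤ b → dist A x ≤ dist A B →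
      x.coord = a • A.coord + b • B.coord → x ∈ F) :
    intrinsicDist F A B ≤ edist A B := by
  obtain ⟨γ, hγ, rfl, rfl, hc⟩ := exists_geodesic A B
  rw [edist_nndist]
  refine intrinsicDist_le_of_lipschitz hγ fun t ht => ?_
  obtain ⟨a, b, ha, hb, hab⟩ := hc t ht
  refine h _ a b ha hb ?_ hab
  have := hγ.dist_le_mul 0 t
  rw [dist_zero_left, Real.norm_of_nonneg ht.1, coe_nndist] at this
  exact this.trans (mul_le_of_le_one_right dist_nonneg ht.2)

/-- Curves which avoid the interior of a convex body are at least as long as the intrinsic distance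
on the boundary: project them. -/
theorem IsConvex.intrinsicDist_frontier_le {K : Set Hyp3} (hK : IsConvex K) (hc : IsCompact K)
    {X Y : Hyp3} (hX : X ∈ frontier K) (hY : Y ∈ frontier K) :
    intrinsicDist (frontier K) X Y ≤ intrinsicDist (interior K)ᶜ X Y := by
  have hX' := hc.isClosed.frontier_subset hX
  have hY' := hc.isClosed.frontier_subset hY
  obtain ⟨P, hP, hfix, hout⟩ := hK.exists_projection hc ⟨X, hX'⟩
  have := intrinsicDist_map_le one_ne_zero (hP.lipschitzOnWith (s := (interior K)ᶜ)) hout X Y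
  rwa [hfix X hX', hfix Y hY', ENNReal.coe_one, one_mul] at this

/-! ### Convex sets and their boundaries -/

/-- A curve that leaves a set meets its boundary. -/
theorem exists_mem_frontier_of_curve {K : Set Hyp3} {γ : ℝ → Hyp3} (hγ : Continuous γ) {a b : ℝ}
    (hab : a ≤ b) (ha : γ a ∈ K) (hb : γ b ∉ K) : ∃ t ∈ Icc a b, γ t ∈ frontier K := by
  by_contra! h
  have hsub : Icc a b ⊆ γ ⁻¹' interior K ∪ γ ⁻¹' (closure K)ᶜ := fun t ht => by
    by_contra hn
    rw [mem_union, not_or] at hn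
    exact h t ht ⟨not_not.1 hn.2, hn.1⟩
  obtain ⟨t, -, h1, h2⟩ := isPreconnected_Icc _ _ (isOpen_interior.preimage hγ)
    (isClosed_closure.isOpen_compl.preimage hγ) hsub
    ⟨a, left_mem_Icc.2 hab, by
      by_contra hn
      exact h a (left_mem_Icc.2 hab) ⟨subset_closure ha, hn⟩⟩
    ⟨b, right_mem_Icc.2 hab, fun hn =>
      h b (right_mem_Icc.2 hab) ⟨hn, fun hi => hb (interior_subset hi)⟩⟩
  exact h2 (interior_subset_closure h1)

/-- A ball without boundary points of `K` lies inside `K` or outside of it. -/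
theorem mem_iff_of_ball_disjoint_frontier {K : Set Hyp3} {o A : Hyp3} {r : ℝ}
    (hF : ∀ x ∈ frontier K, r ≤ dist o x) (hA : A ∈ Metric.ball o r) : o ∈ K ↔ A ∈ K := by
  obtain ⟨γ, hγ, h0, h1, -⟩ := exists_geodesic o A
  rw [Metric.mem_ball, dist_comm] at hA
  have hnear : ∀ t ∈ Icc (0 : ℝ) 1, γ t ∉ frontier K := fun t ht hf => by
    have h2 := hγ.dist_le_mul 0 t
    rw [dist_zero_left, Real.norm_of_nonneg ht.1, coe_nndist, h0] at h2
    have h3 : dist o A * t ≤ dist o A := mul_le_of_le_one_right dist_nonneg ht.2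
    linarith [hF _ hf]
  constructor
  · intro ho
    by_contra hn
    obtain ⟨t, ht, hf⟩ := exists_mem_frontier_of_curve (K := K) hγ.continuous zero_le_one
      (h0.symm ▸ ho) (h1.symm ▸ hn)
    exact hnear t ht hf
  · intro hAK
    by_contra hn
    obtain ⟨t, ht, hf⟩ := exists_mem_frontier_of_curve (K := Kᶜ) hγ.continuous zero_le_one
      (show γ 0 ∈ Kᶜ from h0.symm ▸ hn) (fun h => h (h1.symm ▸ hAK))
    rw [frontier_compl] at hf
    exact hnear t ht hf

/-- In the three-dimensional tangent space at `o` there is a unit vector orthogonal to two given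
vectors. -/
theorem exists_unit_orthogonal (o : Hyp3) (u v : Fin 4 → ℝ) :
    ∃ w, minkowski o.coord w = 0 ∧ minkowski u w = 0 ∧ minkowski v w = 0 ∧ minkowski w w = 1 := by
  let L : (Fin 4 → ℝ) →ₗ[ℝ] (Fin 3 → ℝ) :=
    { toFun := fun w => ![minkowski o.coord w, minkowski u w, minkowski v w]
      map_add' := fun x y => by ext i; fin_cases i <;> simp [minkowski_add_right]
      map_smul' := fun s x => by ext i; fin_cases i <;> simp [minkowski_smul_right] }
  obtain ⟨w, hw, hw0⟩ := Submodule.exists_mem_ne_zero_of_ne_bot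
    (LinearMap.ker_ne_bot_of_finrank_lt (f := L) (by simp))
  have hL : ![minkowski o.coord w, minkowski u w, minkowski v w] = 0 := hw
  have e0 : minkowski o.coord w = 0 := congrFun hL 0
  have e1 : minkowski u w = 0 := congrFun hL 1
  have e2 : minkowski v w = 0 := congrFun hL 2
  have hpos : 0 < minkowski w w := by
    have h1 := sq_le_of_orthogonal o w (by rw [minkowski_comm]; exact e0)
    refine (minkowski_nonneg_of_orthogonal o w (by rw [minkowski_comm]; exact e0)).lt_of_ne ?_
    intro h2
    rw [← h2, mul_zero] at h1
    have a1 : w 1 = 0 := by nlinarith [sq_nonneg (w 2), sq_nonneg (w 3)]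
    have a2 : w 2 = 0 := by nlinarith [sq_nonneg (w 1), sq_nonneg (w 3)]
    have a3 : w 3 = 0 := by nlinarith [sq_nonneg (w 1), sq_nonneg (w 2)]
    have a0 : w 0 = 0 := by
      simp only [minkowski, a1, a2, a3] at h2
      nlinarith
    exact hw0 (by ext i; fin_cases i <;> assumption)
  refine ⟨(√(minkowski w w))⁻¹ • w, ?_, ?_, ?_, ?_⟩
  · rw [minkowski_smul_right, e0, mul_zero]
  · rw [minkowski_smul_right, e1, mul_zero]
  · rw [minkowski_smul_right, e2, mul_zero]
  · have h2 := Real.sq_sqrt hpos.le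
    have h3 := (Real.sqrt_pos.2 hpos).ne'
    rw [minkowski_smul_left, minkowski_smul_right]
    field_simp
    linarith

/-- Every point of a compact set lies between two boundary points. -/
theorem exists_frontier_combination {K : Set Hyp3} (hc : IsCompact K) {o : Hyp3} (ho : o ∈ K) :
    ∃ w₁ ∈ frontier K, ∃ w₂ ∈ frontier K, ∃ s t : ℝ, 0 ≤ s ∧ 0 ≤ t ∧
      o.coord = s • w₁.coord + t • w₂.coord := by
  obtain ⟨e, he, -, -, h1⟩ := exists_unit_orthogonal o 0 0
  obtain ⟨R, hR0, hR⟩ := hc.isBounded.subset_ball_lt 0 o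
  have hout : ∀ t, |t| = R → ray o e t ∉ K := fun t ht hmem => by
    have := hR hmem
    rw [Metric.mem_ball, dist_comm, dist_ray he h1, ht] at this
    exact this.false
  have hcont := (isometry_ray he h1).continuous
  obtain ⟨t₁, ht₁, hf₁⟩ := exists_mem_frontier_of_curve (K := K) hcont hR0.le
    (by rwa [ray_zero he h1]) (hout R (abs_of_pos hR0))
  obtain ⟨t₂, ht₂, hf₂⟩ := exists_mem_frontier_of_curve (K := K) (γ := fun t => ray o e (-t))
    (hcont.comp continuous_neg) hR0.le
    (by simpa [ray_zero he h1] using ho) (hout (-R) (by rw [abs_neg, abs_of_pos hR0]))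
  rcases (add_nonneg ht₁.1 ht₂.1).eq_or_lt with h0 | h0
  · have : t₁ = 0 := by linarith [ht₁.1, ht₂.1]
    rw [this, ray_zero he h1] at hf₁
    exact ⟨o, hf₁, o, hf₁, 1, 0, zero_le_one, le_rfl, by simp⟩
  · have hS : 0 < Real.sinh (t₁ + t₂) := Real.sinh_pos_iff.2 h0
    refine ⟨_, hf₁, _, hf₂, Real.sinh t₂ / Real.sinh (t₁ + t₂),
      Real.sinh t₁ / Real.sinh (t₁ + t₂), div_nonneg (Real.sinh_nonneg_iff.2 ht₂.1) hS.le,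
      div_nonneg (Real.sinh_nonneg_iff.2 ht₁.1) hS.le, ?_⟩
    rw [ray_coord he h1, ray_coord he h1, Real.cosh_neg, Real.sinh_neg]
    ext i
    simp only [Pi.add_apply, Pi.smul_apply, smul_eq_mul]
    field_simp
    rw [Real.sinh_add]
    ring

/-- A point in the cone over `w₁` and `w₂` is approximated from the cones over nearby points. -/
theorem eventually_exists_combination {o w₁ w₂ : Hyp3} {s t r : ℝ} (hs : 0 ≤ s) (ht : 0 ≤ t)
    (h : o.coord = s • w₁.coord + t • w₂.coord) (hr : 0 < r) :
    ∀ᶠ w : Hyp3 × Hyp3 in 𝓝 (w₁, w₂), ∃ o' ∈ Metric.ball o r, ∃ a b : ℝ, 0 ≤ a ∧ 0 ≤ b ∧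
      o'.coord = a • w.1.coord + b • w.2.coord := by
  have hoo := o.minkowski_self
  -- `n` and `q` are `-(o, v)` and `-(v, v)` for `v = s w.1 + t w.2`
  set n : Hyp3 × Hyp3 → ℝ := fun w =>
    s * Real.cosh (dist o w.1) + t * Real.cosh (dist o w.2) with hn
  set q : Hyp3 × Hyp3 → ℝ := fun w =>
    s ^ 2 + t ^ 2 + 2 * s * t * Real.cosh (dist w.1 w.2) with hq
  have ncont : Continuous n := by
    have h1 : Continuous fun w : Hyp3 × Hyp3 => dist o w.1 := by fun_prop
    have h2 : Continuous fun w : Hyp3 × Hyp3 => dist o w.2 := by fun_prop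
    exact ((Real.continuous_cosh.comp h1).const_mul s).add
      ((Real.continuous_cosh.comp h2).const_mul t)
  have qcont : Continuous q := by
    have h1 : Continuous fun w : Hyp3 × Hyp3 => dist w.1 w.2 := by fun_prop
    exact ((Real.continuous_cosh.comp h1).const_mul _).const_add _
  have n_eq : ∀ w : Hyp3 × Hyp3, minkowski (s • w.1.coord + t • w.2.coord) o.coord = -n w := by
    intro w
    simp only [hn, cosh_dist, minkowski_add_left, minkowski_smul_left,
      minkowski_comm w.1.coord o.coord, minkowski_comm w.2.coord o.coord]
    ring
  have q_eq : ∀ w : Hyp3 × Hyp3, minkowski (s • w.1.coord + t • w.2.coord)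
      (s • w.1.coord + t • w.2.coord) = -q w := by
    intro w
    simp only [hq, cosh_dist, minkowski_add_left, minkowski_smul_left, minkowski_add_right,
      minkowski_smul_right, minkowski_self, minkowski_comm w.2.coord w.1.coord]
    ring
  have n0 : n (w₁, w₂) = 1 := by
    have := n_eq (w₁, w₂)
    rw [← h, hoo] at this
    linarith
  have q0 : q (w₁, w₂) = 1 := by
    have := q_eq (w₁, w₂)
    rw [← h, hoo] at this
    linarith
  have hch : 1 < Real.cosh r := Real.one_lt_cosh.2 hr.ne'
  have e1 : ∀ᶠ w in 𝓝 (w₁, w₂), 0 < n w :=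
    ncont.continuousAt.eventually_const_lt (by rw [n0]; exact one_pos)
  have e2 : ∀ᶠ w in 𝓝 (w₁, w₂), 0 < q w :=
    qcont.continuousAt.eventually_const_lt (by rw [q0]; exact one_pos)
  have e3 : ∀ᶠ w in 𝓝 (w₁, w₂), n w ^ 2 < Real.cosh r ^ 2 * q w := by
    refine (ncont.pow 2).continuousAt.eventually_lt (qcont.const_mul _).continuousAt ?_
    rw [Pi.pow_apply, n0, q0, one_pow, mul_one]
    exact one_lt_pow₀ hch two_ne_zero
  filter_upwards [e1, e2, e3] with w h1 h2 h3
  obtain ⟨hN, hN2, hv⟩ := smul_normalize o (v := s • w.1.coord + t • w.2.coord)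
    (by rw [q_eq]; linarith) (by rw [n_eq]; linarith)
  set o' := normalize (s • w.1.coord + t • w.2.coord)
  set N := √(-minkowski (s • w.1.coord + t • w.2.coord) (s • w.1.coord + t • w.2.coord))
  rw [q_eq, neg_neg] at hN2
  refine ⟨o', ?_, N⁻¹ * s, N⁻¹ * t, mul_nonneg (inv_nonneg.2 hN.le) hs,
    mul_nonneg (inv_nonneg.2 hN.le) ht, ?_⟩
  · have h4 : N * -minkowski o'.coord o.coord = n w := by
      rw [mul_neg, ← minkowski_smul_left, hv, n_eq, neg_neg]
    rw [Metric.mem_ball]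
    refine dist_lt_of_cosh_lt hr.le (lt_of_pow_lt_pow_left₀ 2 (by positivity) ?_)
    rw [← h4, mul_pow, ← hN2, mul_comm] at h3
    exact lt_of_mul_lt_mul_right h3 (sq_nonneg N)
  · rw [mul_smul, mul_smul, ← smul_add, ← hv, smul_smul, inv_mul_cancel₀ hN.ne', one_smul]

/-- Convex sets whose boundaries converge to the boundary of a set with the interior point `o`
eventually contain a fixed ball around `o`: the point `o` lies between two boundary points of the
limit, hence near a point between two boundary points of the approximating sets, and the latter
have no boundary points near `o`. -/
theorem eventually_ball_subset {K : ℕ → Set Hyp3} {K' : Set Hyp3} (hK : ∀ n, IsConvex (K n))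
    (hc : ∀ n, IsCompact (K n)) (hc' : IsCompact K')
    (hclose : ∀ ε > 0, ∀ᶠ n in atTop, (∀ x ∈ frontier (K n), ∃ y ∈ frontier K', dist x y < ε) ∧
      ∀ x ∈ frontier K', ∃ y ∈ frontier (K n), dist x y < ε)
    {o : Hyp3} {r : ℝ} (hr : 0 < r) (hball : Metric.ball o (2 * r) ⊆ K') :
    ∀ᶠ n in atTop, Metric.ball o r ⊆ K n := by
  obtain ⟨w₁, hw₁, w₂, hw₂, s, t, hs, ht, hst⟩ := exists_frontier_combination hc'
    (hball (Metric.mem_ball_self (by linarith)))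
  obtain ⟨ε, hε, hcomb⟩ := Metric.eventually_nhds_iff.1
    (eventually_exists_combination hs ht hst hr)
  filter_upwards [hclose ε hε, hclose r hr] with n hn₁ hn₂
  have hdis : ∀ x ∈ frontier (K n), r ≤ dist o x := by
    intro x hx
    by_contra! hlt
    obtain ⟨y, hy, hxy⟩ := hn₂.1 x hx
    have hyb : y ∈ Metric.ball o (2 * r) := by
      rw [Metric.mem_ball, dist_comm]
      linarith [dist_triangle o x y]
    exact hy.2 (interior_maximal hball Metric.isOpen_ball hyb)
  obtain ⟨y₁, hy₁, hwy₁⟩ := hn₁.2 w₁ hw₁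
  obtain ⟨y₂, hy₂, hwy₂⟩ := hn₁.2 w₂ hw₂
  obtain ⟨o', ho', a, b, ha, hb, hab⟩ := hcomb (y := (y₁, y₂)) (by
    rw [Prod.dist_eq, dist_comm y₁, dist_comm y₂]; exact max_lt hwy₁ hwy₂)
  have ho'K : o' ∈ K n := (hK n).mem_of_coord_eq ((hc n).isClosed.frontier_subset hy₁)
    ((hc n).isClosed.frontier_subset hy₂) ha hb hab
  have hoK : o ∈ K n := (mem_iff_of_ball_disjoint_frontier hdis ho').2 ho'K
  exact fun A hA => (mem_iff_of_ball_disjoint_frontier hdis hA).1 hoK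

/-- If `o` is an interior point of a convex body, the geodesics which continue the radii from `o`
beyond the boundary avoid the interior. -/
theorem IsConvex.intrinsicDist_radial_le {K : Set Hyp3} (hK : IsConvex K) {o : Hyp3} {r : ℝ}
    (hr : 0 < r) (hball : Metric.ball o r ⊆ K) {A y : Hyp3} (hA : A ∉ interior K) {c d : ℝ}
    (hc : 0 < c) (hd : 0 ≤ d) (h : A.coord = c • o.coord + d • y.coord) :
    intrinsicDist (interior K)ᶜ A y ≤ edist A y := by
  refine intrinsicDist_le_edist_of_segment fun x a b ha hb _ hx hxK => ?_
  -- for `b = 0` the point `x` is `A`; otherwise `A` lies strictly between `o` and `x`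
  rcases hb.eq_or_lt with rfl | hb
  · have h1 := x.minkowski_self
    rw [zero_smul, add_zero] at hx
    rw [hx, minkowski_smul_left, minkowski_smul_right, A.minkowski_self] at h1
    have h2 : a = 1 := by nlinarith
    rw [h2, one_smul] at hx
    exact hA (Hyp3.ext hx ▸ hxK)
  · have hden : 0 < b + d * a := by positivity
    have hAx : A.coord = (b * c / (b + d * a)) • o.coord + (d / (b + d * a)) • x.coord := by
      rw [hx]
      ext i
      have hi := congrFun h i
      simp only [Pi.add_apply, Pi.smul_apply, smul_eq_mul] at hi ⊢
      field_simp
      linear_combination b * hi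
    obtain ⟨δ, hδ, hb'⟩ := exists_ball_subset o (R := dist o A) (κ := b * c / (b + d * a)) hr
      (by positivity)
    exact hA (interior_maximal (hb' K hK hball A x (interior_subset hxK) le_rfl
      ⟨_, _, le_rfl, by positivity, hAx⟩) Metric.isOpen_ball (Metric.mem_ball_self hδ))

/-! ### Finiteness and comparison of intrinsic distances -/

/-- Points of a large sphere whose directions from the centre are orthogonal are joined by an arc
of finite length on the sphere. -/
theorem intrinsicDist_sphere_ne_top {F : Set Hyp3} {o : Hyp3} {R : ℝ} (hR : 0 ≤ R)
    (hF : ∀ x, dist o x = R → x ∈ F) {e e' : Fin 4 → ℝ} (he : minkowski o.coord e = 0)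
    (h1 : minkowski e e = 1) (he' : minkowski o.coord e' = 0) (h1' : minkowski e' e' = 1)
    (hee : minkowski e e' = 0) : intrinsicDist F (ray o e R) (ray o e' R) ≠ ⊤ := by
  set u : ℝ → Fin 4 → ℝ := fun τ =>
    Real.cos (Real.pi / 2 * τ) • e + Real.sin (Real.pi / 2 * τ) • e' with hu
  have uu : ∀ s t, minkowski (u s) (u t) = Real.cos (Real.pi / 2 * s - Real.pi / 2 * t) := by
    intro s t
    simp only [hu, minkowski_add_left, minkowski_smul_left, minkowski_add_right,
      minkowski_smul_right, h1, h1', hee, minkowski_comm e' e, Real.cos_sub]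
    ring
  have u1 : ∀ s, minkowski (u s) (u s) = 1 := fun s => by rw [uu, sub_self, Real.cos_zero]
  have uo : ∀ s, minkowski o.coord (u s) = 0 := fun s => by
    simp only [hu, minkowski_add_right, minkowski_smul_right, he, he']; ring
  have hS : 0 ≤ Real.sinh R := Real.sinh_nonneg_iff.2 hR
  have hL : 0 ≤ Real.sinh R * (Real.pi / 2) := mul_nonneg hS (by positivity)
  have hlip : LipschitzWith (Real.toNNReal (Real.sinh R * (Real.pi / 2)))
      (fun τ => ray o (u τ) R) := by
    refine LipschitzWith.of_dist_le_mul fun s t => ?_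
    rw [Real.coe_toNNReal _ hL]
    have hnn : 0 ≤ Real.sinh R * (Real.pi / 2) * dist s t := mul_nonneg hL dist_nonneg
    refine dist_le_of_cosh_le hnn ?_
    rw [minkowski_ray_ray (uo s) (u1 s) (uo t) (u1 t), uu]
    have c1 := Real.one_sub_sq_div_two_le_cos (x := Real.pi / 2 * s - Real.pi / 2 * t)
    have c2 := cosh_sub_one (Real.sinh R * (Real.pi / 2) * dist s t)
    have c3 := Real.self_le_sinh_iff.2 (div_nonneg hnn zero_le_two)
    have c4 := pow_le_pow_left₀ (div_nonneg hnn zero_le_two) c3 2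
    have c5 : dist s t ^ 2 = (s - t) ^ 2 := by rw [Real.dist_eq, sq_abs]
    have c6 : (Real.sinh R * (Real.pi / 2) * dist s t / 2) ^ 2
        = Real.sinh R ^ 2 * (Real.pi / 2 * s - Real.pi / 2 * t) ^ 2 / 4 := by
      rw [div_pow, mul_pow, mul_pow, c5]; ring
    have c7 := mul_le_mul_of_nonneg_left c1 (sq_nonneg (Real.sinh R))
    have c8 := Real.cosh_sq R
    linarith
  have hγ := intrinsicDist_le_of_lipschitz hlip (F := F) fun τ _ => hF _ (by
    rw [dist_ray (uo τ) (u1 τ), abs_of_nonneg hR])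
  have u_zero : u 0 = e := by simp [hu]
  have u_one : u 1 = e' := by simp [hu]
  rw [u_zero, u_one] at hγ
  exact ne_top_of_le_ne_top ENNReal.coe_ne_top hγ

/-- Intrinsic distances on closed convex surfaces are finite. For a surface that bounds a convex
body, run along radii to a large sphere, there along two quarter circles, and project the curve to
the surface. -/
theorem IsClosedConvexSurface.intrinsicDist_ne_top {F : Set Hyp3} (hF : IsClosedConvexSurface F)
    {A B : Hyp3} (hA : A ∈ F) (hB : B ∈ F) : intrinsicDist F A B ≠ ⊤ := by
  obtain ⟨K, -, hc, hK, rfl⟩ := hF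
  rcases (interior K).eq_empty_or_nonempty with hint | ⟨o, ho⟩
  · have hfr : frontier K = K := by rw [hc.isClosed.frontier_eq, hint, sdiff_empty]
    rw [hfr] at hA hB ⊢
    exact ne_top_of_le_ne_top (edist_ne_top A B) (intrinsicDist_le_edist_of_segment
      fun x a b ha hb _ hx => hK.mem_of_coord_eq hA hB ha hb hx)
  obtain ⟨r, hr, hball⟩ := Metric.mem_nhds_iff.1 (mem_interior_iff_mem_nhds.1 ho)
  obtain ⟨R, hR0, hR⟩ := hc.isBounded.subset_ball_lt 0 o
  have hsphere : ∀ x, dist o x = R → x ∈ (interior K)ᶜ := fun x hx hxK => by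
    have := hR (interior_subset hxK)
    rw [Metric.mem_ball, dist_comm, hx] at this
    exact this.false
  have hradial : ∀ A ∈ frontier K, ∃ e, minkowski o.coord e = 0 ∧ minkowski e e = 1 ∧
      intrinsicDist (interior K)ᶜ A (ray o e R) ≠ ⊤ := by
    intro A hA
    have hne : o ≠ A := fun h => hA.2 (h ▸ ho)
    obtain ⟨e, he, h1, hAe⟩ := exists_ray hne
    refine ⟨e, he, h1, ne_top_of_le_ne_top (edist_ne_top A (ray o e R)) ?_⟩
    have hlt : dist o A < R := by
      rw [dist_comm]; exact hR (hc.isClosed.frontier_subset hA)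
    have hSR : 0 < Real.sinh R := Real.sinh_pos_iff.2 hR0
    refine hK.intrinsicDist_radial_le hr hball hA.2
      (c := Real.sinh (R - dist o A) / Real.sinh R) (d := Real.sinh (dist o A) / Real.sinh R)
      (div_pos (Real.sinh_pos_iff.2 (by linarith)) hSR)
      (div_nonneg (Real.sinh_nonneg_iff.2 dist_nonneg) hSR.le) ?_
    conv_lhs => rw [← hAe]
    rw [ray_coord he h1, ray_coord he h1, Real.sinh_sub]
    ext i
    simp only [Pi.add_apply, Pi.smul_apply, smul_eq_mul]
    field_simp
    ring
  obtain ⟨u, hu, u1, hAu⟩ := hradial A hA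
  obtain ⟨v, hv, v1, hBv⟩ := hradial B hB
  -- the detour over a direction orthogonal to both also serves opposite directions `u` and `v`
  obtain ⟨w, hw, huw, hvw, w1⟩ := exists_unit_orthogonal o u v
  have h1 := intrinsicDist_sphere_ne_top hR0.le hsphere hu u1 hw w1 huw
  have h2 := intrinsicDist_sphere_ne_top hR0.le hsphere hv v1 hw w1 hvw
  rw [intrinsicDist_comm] at hBv h2
  refine ne_top_of_le_ne_top ?_ ((hK.intrinsicDist_frontier_le hc hA hB).trans
    (intrinsicDist_triangle _ A (ray o u R) B))
  refine ENNReal.add_ne_top.2 ⟨hAu, ne_top_of_le_ne_top ?_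
    (intrinsicDist_triangle _ _ (ray o w R) B)⟩
  exact ENNReal.add_ne_top.2 ⟨h1, ne_top_of_le_ne_top (ENNReal.add_ne_top.2 ⟨h2, hBv⟩)
    (intrinsicDist_triangle _ _ (ray o v R) B)⟩

/-- Comparison of intrinsic distances: if the set `F` is close to the boundary of a convex body `K`,
then curves in `F`, pushed out of `K` and projected back, give curves on the boundary of `K` that
are not much longer. The closeness needed depends only on an inner and an outer radius of `K`. -/
theorem exists_intrinsicDist_frontier_le (o : Hyp3) {r R e : ℝ} (hr : 0 < r) (he : 0 < e) :
    ∃ δ > 0, ∀ K : Set Hyp3, IsConvex K → IsCompact K → Metric.ball o r ⊆ K →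
      (∀ x ∈ frontier K, dist o x ≤ R) → ∀ F : Set Hyp3,
      (∀ x ∈ F, ∃ y ∈ frontier K, dist x y < δ) →
      ∀ A₁ ∈ F, ∀ B₁ ∈ F, ∀ A₂ ∈ frontier K, ∀ B₂ ∈ frontier K,
      dist A₂ A₁ < δ → dist B₂ B₁ < δ →
      intrinsicDist (frontier K) A₂ B₂ ≤ ENNReal.ofReal (1 + e) *
        (ENNReal.ofReal e + intrinsicDist F A₁ B₁ + ENNReal.ofReal e)
          + ENNReal.ofReal e + ENNReal.ofReal e := by
  obtain ⟨κ, f, hκ, hf, hlip⟩ := exists_push o (Real.one_le_cosh (R + 1)) he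
  obtain ⟨δ₀, hδ₀, hnbhd⟩ := exists_ball_subset o (R := R + 1) hr hκ
  refine ⟨min δ₀ (min 1 e), by positivity, fun K hK hc hball hout F hF A₁ hA₁ B₁ hB₁ A₂ hA₂ B₂
    hB₂ hA hB => ?_⟩
  set δ := min δ₀ (min 1 e) with hδ
  have hδ1 : δ ≤ 1 := (min_le_right _ _).trans (min_le_left _ _)
  have hδe : δ ≤ e := (min_le_right _ _).trans (min_le_right _ _)
  have hδ2 : δ ≤ δ₀ := min_le_left _ _
  have hδpos : 0 < δ := dist_nonneg.trans_lt hA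
  -- the neighbourhood of the surface in which the comparison curve runs
  set T : Set Hyp3 := {x | ∃ y ∈ frontier K, dist x y < δ} with hT
  have hTR : ∀ x ∈ T, dist o x ≤ R + 1 := by
    rintro x ⟨y, hy, hxy⟩
    rw [dist_comm x y] at hxy
    linarith [dist_triangle o y x, hout y hy]
  have hTM : ∀ x ∈ T, -minkowski o.coord x.coord ≤ Real.cosh (R + 1) := fun x hx =>
    neg_minkowski_le_cosh (hTR x hx)
  have hfT : MapsTo f T (interior K)ᶜ := by
    intro x hx hfx
    obtain ⟨⟨N, hN, hxN⟩, -⟩ := hf x (hTM x hx)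
    have hsub := hnbhd K hK hball x (f x) (interior_subset hfx) (hTR x hx)
      ⟨_, N, le_mul_of_one_le_right hκ.le (one_le_neg_minkowski o x), hN.le, hxN⟩
    obtain ⟨y, hy, hxy⟩ := hx
    refine hy.2 (interior_maximal hsub Metric.isOpen_ball ?_)
    rw [Metric.mem_ball, dist_comm]
    exact hxy.trans_le hδ2
  have hflip : LipschitzOnWith (Real.toNNReal (1 + e)) f T :=
    LipschitzOnWith.of_dist_le_mul fun x hx y hy => by
      rw [Real.coe_toNNReal _ (by linarith)]
      exact hlip x y (hTM x hx) (hTM y hy)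
  have hmap := intrinsicDist_map_le (by simpa using (by linarith : 0 < 1 + e)) hflip hfT A₂ B₂
  have hedist : ∀ {x y : Hyp3}, dist x y ≤ e → edist x y ≤ ENNReal.ofReal e := fun h => by
    rw [edist_dist]; exact ENNReal.ofReal_le_ofReal h
  have hshort : ∀ {A C : Hyp3}, A ∈ frontier K → dist A C < δ →
      intrinsicDist T A C ≤ ENNReal.ofReal e := fun {A C} hA hAC =>
    (intrinsicDist_le_edist_of_segment (F := T) fun x a b _ _ hx _ =>
      ⟨A, hA, (dist_comm x A).trans_lt (hx.trans_lt hAC)⟩).trans (hedist (hAC.le.trans hδe))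
  have hT12 : intrinsicDist T A₂ B₂ ≤
      ENNReal.ofReal e + intrinsicDist F A₁ B₁ + ENNReal.ofReal e := by
    refine (intrinsicDist_triangle T A₂ B₁ B₂).trans (add_le_add
      ((intrinsicDist_triangle T A₂ A₁ B₁).trans (add_le_add (hshort hA₂ hA)
        (intrinsicDist_anti hF A₁ B₁))) ?_)
    rw [intrinsicDist_comm]
    exact hshort hB₂ hB
  have hpush : ∀ A ∈ frontier K,
      intrinsicDist (interior K)ᶜ A (f A) ≤ ENNReal.ofReal e := fun A hA => by
    obtain ⟨⟨N, hN, hAN⟩, hd⟩ := hf A (hTM A ⟨A, hA, by rwa [dist_self]⟩)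
    exact (hK.intrinsicDist_radial_le hr hball hA.2
      (mul_pos hκ (one_pos.trans_le (one_le_neg_minkowski o A))) hN.le hAN).trans (hedist hd)
  calc intrinsicDist (frontier K) A₂ B₂
      ≤ intrinsicDist (interior K)ᶜ A₂ B₂ := hK.intrinsicDist_frontier_le hc hA₂ hB₂
    _ ≤ intrinsicDist (interior K)ᶜ A₂ (f A₂) + (intrinsicDist (interior K)ᶜ (f A₂) (f B₂)
          + intrinsicDist (interior K)ᶜ (f B₂) B₂) :=
        (intrinsicDist_triangle _ _ _ _).trans
          (add_le_add le_rfl (intrinsicDist_triangle _ _ _ _))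
    _ ≤ ENNReal.ofReal e + (ENNReal.ofReal (1 + e) *
          (ENNReal.ofReal e + intrinsicDist F A₁ B₁ + ENNReal.ofReal e) + ENNReal.ofReal e) := by
        refine add_le_add (hpush A₂ hA₂) (add_le_add (hmap.trans (mul_le_mul_right hT12 _)) ?_)
        rw [intrinsicDist_comm]
        exact hpush B₂ hB₂
    _ = _ := by ring

end Hyp3

theorem mainTheorem5 (F : ℕ → Set Hyp3) (F' : Set Hyp3)
    (hF : ∀ n, Hyp3.IsClosedConvexSurface (F n))
    (hF' : Hyp3.IsNondegenerateClosedConvexSurface F')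
    (hconv : Hyp3.SurfacesConverge F F')
    (X Y : ℕ → Hyp3) (X' Y' : Hyp3)
    (hX : ∀ n, X n ∈ F n) (hY : ∀ n, Y n ∈ F n) (hX' : X' ∈ F') (hY' : Y' ∈ F')
    (hXlim : Tendsto X atTop (𝓝 X')) (hYlim : Tendsto Y atTop (𝓝 Y')) :
    (∀ n, Hyp3.intrinsicDist (F n) (X n) (Y n) ≠ ⊤) ∧
      Hyp3.intrinsicDist F' X' Y' ≠ ⊤ ∧
      Tendsto (fun n => Hyp3.intrinsicDist (F n) (X n) (Y n)) atTop
        (𝓝 (Hyp3.intrinsicDist F' X' Y')) := by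
  have hfin : ∀ n, Hyp3.intrinsicDist (F n) (X n) (Y n) ≠ ⊤ := fun n =>
    (hF n).intrinsicDist_ne_top (hX n) (hY n)
  obtain ⟨K', ⟨o, ho⟩, hc', hK', rfl⟩ := hF'
  have hfin' : Hyp3.intrinsicDist (frontier K') X' Y' ≠ ⊤ :=
    Hyp3.IsClosedConvexSurface.intrinsicDist_ne_top
      ⟨K', ⟨o, interior_subset ho⟩, hc', hK', rfl⟩ hX' hY'
  refine ⟨hfin, hfin', ?_⟩
  choose K _ hc hK hFK using hF
  obtain rfl : F = fun n => frontier (K n) := funext hFK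
  have hclose : ∀ ε > 0, ∀ᶠ n in atTop,
      (∀ x ∈ frontier (K n), ∃ y ∈ frontier K', dist x y < ε) ∧
        ∀ x ∈ frontier K', ∃ y ∈ frontier (K n), dist x y < ε := by
    intro ε hε
    filter_upwards [hconv.eventually_lt_const (ENNReal.ofReal_pos.2 hε)] with n hn
    refine ⟨fun x hx => ?_, fun x hx => ?_⟩
    · obtain ⟨y, hy, hxy⟩ := Metric.exists_edist_lt_of_hausdorffEDist_lt hx hn
      exact ⟨y, hy, edist_lt_ofReal.1 hxy⟩
    · rw [Metric.hausdorffEDist_comm] at hn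
      obtain ⟨y, hy, hxy⟩ := Metric.exists_edist_lt_of_hausdorffEDist_lt hx hn
      exact ⟨y, hy, edist_lt_ofReal.1 hxy⟩
  obtain ⟨ρ, hρ, hball⟩ := Metric.mem_nhds_iff.1 (mem_interior_iff_mem_nhds.1 ho)
  obtain ⟨r, hr, rfl⟩ : ∃ r, 0 < r ∧ ρ = 2 * r := ⟨ρ / 2, by positivity, by ring⟩
  obtain ⟨R, hR⟩ := hc'.isBounded.subset_closedBall o
  have hR' : ∀ x ∈ frontier K', dist o x ≤ R := fun x hx => by
    rw [dist_comm]; exact hR (hc'.isClosed.frontier_subset hx)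
  have hballs := Hyp3.eventually_ball_subset hK hc hc' hclose hr hball
  have hbound : ∀ᶠ n in atTop, ∀ x ∈ frontier (K n), dist o x ≤ R + 1 := by
    filter_upwards [hclose 1 one_pos] with n hn x hx
    obtain ⟨y, hy, hxy⟩ := hn.1 x hx
    rw [dist_comm] at hxy
    linarith [dist_triangle o y x, hR' y hy]
  -- both comparisons of the intrinsic distances have the form `d₁ ≤ bound e d₂`, for all `e > 0`
  set bound : ℝ → ℝ≥0∞ → ℝ≥0∞ := fun e z => ENNReal.ofReal (1 + e) *
    (ENNReal.ofReal e + z + ENNReal.ofReal e) + ENNReal.ofReal e + ENNReal.ofReal e with hbd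
  have hbound_mono : ∀ e, Monotone (bound e) := fun e a b hab => by
    simp only [hbd]; gcongr
  have hbound_lim : ∀ z, z ≠ ⊤ → Tendsto (fun e => bound e z) (𝓝[>] 0) (𝓝 z) := by
    intro z hz
    have t0 : Tendsto (fun e : ℝ => ENNReal.ofReal e) (𝓝[>] 0) (𝓝 0) := by
      have := (ENNReal.continuous_ofReal.tendsto 0).mono_left (nhdsWithin_le_nhds (s := Ioi 0))
      rwa [ENNReal.ofReal_zero] at this
    have t1 : Tendsto (fun e : ℝ => ENNReal.ofReal (1 + e)) (𝓝[>] 0) (𝓝 1) := by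
      have := ((ENNReal.continuous_ofReal.comp (continuous_const_add (1 : ℝ))).tendsto 0).mono_left
        (nhdsWithin_le_nhds (s := Ioi 0))
      simpa [Function.comp_def] using this
    have := ((ENNReal.Tendsto.mul t1 (Or.inr (by simpa using hz))
      ((t0.add_const z).add t0) (Or.inr ENNReal.one_ne_top)).add t0).add t0
    simpa using this
  have hcomp : ∀ e > 0, ∀ᶠ n in atTop,
      Hyp3.intrinsicDist (frontier (K n)) (X n) (Y n)
          ≤ bound e (Hyp3.intrinsicDist (frontier K') X' Y') ∧
        Hyp3.intrinsicDist (frontier K') X' Y'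
          ≤ bound e (Hyp3.intrinsicDist (frontier (K n)) (X n) (Y n)) := by
    intro e he
    obtain ⟨δ, hδ, hcmp⟩ := Hyp3.exists_intrinsicDist_frontier_le o (R := R + 1) hr he
    filter_upwards [hclose δ hδ, hballs, hbound, Metric.tendsto_nhds.1 hXlim δ hδ,
      Metric.tendsto_nhds.1 hYlim δ hδ] with n h1 h2 h3 h4 h5
    refine ⟨hcmp (K n) (hK n) (hc n) h2 h3 (frontier K') h1.2 X' hX' Y' hY' _ (hX n) _ (hY n)
      h4 h5, ?_⟩
    rw [dist_comm] at h4 h5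
    exact hcmp K' hK' hc' ((Metric.ball_subset_ball (by linarith)).trans hball)
      (fun x hx => (hR' x hx).trans (by linarith)) (frontier (K n)) h1.1 _ (hX n) _ (hY n)
      X' hX' Y' hY' h4 h5
  refine tendsto_order.2 ⟨fun a ha => ?_, fun b hb => ?_⟩
  · obtain ⟨e, hlt, he⟩ := (((hbound_lim a ha.ne_top).eventually_lt_const ha).and
      self_mem_nhdsWithin).exists
    filter_upwards [hcomp e he] with n hn
    by_contra! hle
    exact (hn.2.trans (hbound_mono e hle)).not_gt hlt
  · obtain ⟨e, hlt, he⟩ := (((hbound_lim _ hfin').eventually_lt_const hb).and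
      self_mem_nhdsWithin).exists
    filter_upwards [hcomp e he] with n hn
    exact hn.1.trans_lt hlt
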